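/- **Conventions.** A relation from $X$ to $Y$ is a subset $R\subseteq Y\times X$; $R(A)=\{y:\exists x\in A,\ (y,x)\in R\}$, and $R^{op}$, $R_1\circ R_2$ denote transposition and composition. A coarse structure on $X$ is a family $\mathcal E$ of relations on $X$ (called entourages) containing the diagonal and closed under subsets, finite unions, transposition and composition. A gauge is a symmetric entourage containing the diagonal. $A\subseteq X$ is $E$-bounded if $A\times A\subseteq E$; $A'$ is an $E$-controlled thickening of $A$ if $A\subseteq A'\subseteq E(A)$; $A$ is coarsely contained in $B$, written $A\preccurlyeq B$, if it lies in an $E$-controlled thickening of $B$ for some $E\in\mathcal E$; $D$ is coarsely dense if $X\preccurlyeq D$. The product $Y\times X$ of coarse spaces $(Y,\mathcal F)$, $(X,\mathcal E)$ carries the coarse structure of all relations contained in some $F\otimes E=\{((y,x),(y',x')):(y,y')\in F,\ (x,x')\in E\}$ with $F\in\mathcal F$, $E\in\mathcal E$. A relation $R$ from $X$ to $Y$ is controlled if $R\circ E\circ R^{op}\in\mathcal F$ for all $E\in\mathcal E$. A coarse map is the class $[R]$, up to mutual coarse containment in $Y\times X$, of a controlled relation $R$ whose projection to $X$ is coarsely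 dense. The coarse composition $[S]\circ[R]$ is the least coarse subspace (class of subsets up to mutual coarse containment) that coarsely contains $S'\circ R'$ for all $R'\preccurlyeq R$, $S'\preccurlyeq S$. Coarse maps $[R]\colon X\to Y$ and $[S]\colon Y\to X$ are coarse equivalences, coarse inverse to each other, if $[S]\circ[R]$ and $[R]\circ[S]$ exist and are the classes of the diagonals. A coarse geometric module over $(X,\mathcal E)$ is a Boolean algebra $\mathfrak A\ni X$ of subsets of $X$ (the measurable sets), a complex Hilbert space $H_X$, and orthogonal projections $\chi_A$ ($A\in\mathfrak A$) on $H_X$ with $\chi_{A\cap A'}=\chi_A\chi_{A'}$, $\chi_{A\sqcup A'}=\chi_A+\chi_{A'}$ and $\chi_X=1$, such that for some gauge $G$ the images of $\chi_A$, with $A$ measurable and $G$-bounded, span a dense subspace. The module is * *locally admissible* if for some gauge $G$ every bounded set (i.e. $E$-bounded for some $E\in\mathcal E$) has a measurable $G$-controlled thickening; * *discrete* if for some gauge $G$ there is a partition $X=\bigsqcup_i A_i$ into measurable $G$-bounded sets with $\sum_i\chi_{A_i}=1$ strongly and such that $C\in\mathfrak A$ whenever $C\cap A_i\in\mathfrak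 A$ for all $i$; * *faithful* if for some gauge $G$ the union of the measurable $G$-bounded sets $A$ with $\chi_A\ne0$ is coarsely dense. A submodule of $H_X$ is a closed subspace which, with a unital Boolean subalgebra $\mathfrak A'\subseteq\mathfrak A$ and the restrictions of the $\chi_A$, $A\in\mathfrak A'$, is itself a coarse geometric module; it is denoted by the projection $p$ onto it, and $p\le q$ means that $p$ is a submodule of $q$. An operator $t$ on $H_X$ has $E$-controlled propagation (resp. is $\varepsilon$-$E$-quasi-local) if $\chi_{A'}t\chi_A=0$ (resp. $\|\chi_{A'}t\chi_A\|\le\varepsilon$) for all measurable $A,A'$ with $A'\cap E(A)=\emptyset$. For modules over $(X,\mathcal E)$ and $(Y,\mathcal F)$, a bounded operator $T\colon H_X\to H_Y$ is *weakly quasi-controlled* if $\mathrm{Ad}(T)\colon t\mapsto TtT^*$ is quasi-controlled: for all $E\in\mathcal E$ and $\varepsilon>0$ there is $F\in\mathcal F$ such that $TtT^*$ is $(\varepsilon\|t\|)$-$F$-quasi-local for every bounded $t$ on $H_X$ of $E$-controlled propagation. For $\delta\ge0$, $E\in\mathcal E$, $F\in\mathcal F$ the *approximating relation* of $T$ is $$\Xi_{\delta,F,E}(T)=\bigcup\{B\times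 A:\ B,A\text{ measurable},\ B\ F\text{-bounded},\ A\ E\text{-bounded},\ \|\chi_BT\chi_A\|>\delta\}\subseteq Y\times X.$$ **Theorem.** Let $(X,\mathcal E)$, $(Y,\mathcal F)$ be coarse spaces with coarse geometric modules $H_X$, $H_Y$. (1) Suppose $H_X,H_Y$ are locally admissible. Let $T\colon H_X\to H_Y$ be a bounded operator, let $0\le\mu<\eta/2$, and let $p_X^0\le p_X'\le p_X''$ and $p_Y^0\le p_Y'\le p_Y''$ be chains of submodules of $H_X$ and $H_Y$ such that $$\|p_Y'Tp_X^0-Tp_X^0\|\le\mu,\quad \|p_Y''Tp_X'-Tp_X'\|\le\mu,\quad \|p_X'T^*p_Y^0-T^*p_Y^0\|\le\mu,\quad \|p_X''T^*p_Y'-T^*p_Y'\|\le\mu .$$ Suppose that $p_X^0,p_Y^0$ are faithful; that $p_X',p_Y'$ are discrete; that $\|Tv\|\ge\eta\|v\|$ for $v\in p_X'(H_X)$ and $\|T^*w\|\ge\eta\|w\|$ for $w\in p_Y'(H_Y)$; and that $Tp_X''\colon p_X''(H_X)\to H_Y$ and $T^*p_Y''\colon p_Y''(H_Y)\to H_X$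 are weakly quasi-controlled. Then for every $\mu<\delta<\eta$, for all sufficiently large $E\in\mathcal E$ and $F\in\mathcal F$ (that is, there are $E_0\in\mathcal E$, $F_0\in\mathcal F$ such that the following holds for all $E\in\mathcal E$, $F\in\mathcal F$ with $E\supseteq E_0$, $F\supseteq F_0$), the class of $\Xi_{\delta-\mu,F,E}(p_Y''Tp_X'')$ is a coarse equivalence $X\to Y$ with coarse inverse the class of $\Xi_{\delta-\mu,E,F}(p_X''T^*p_Y'')$. This holds both when these operators are regarded as operators between $H_X$ and $H_Y$ and when they are regarded as operators between the modules $p_X''(H_X)$ and $p_Y''(H_Y)$. (2) Suppose $H_X,H_Y$ are faithful and discrete, and let $U\colon H_X\to H_Y$ be a unitary such that $U$ and $U^*$ are weakly quasi-controlled (that is, $\mathrm{Ad}(U)$ and $\mathrm{Ad}(U^*)$ are quasi-controlled). Then for every $0<\delta<1$ and all sufficiently large $E\in\mathcal E$, $F\in\mathcal F$ (in the same sense), the class of $\Xi_{\delta,F,E}(U)$ is a coarse equivalence $X\to Y$ with coarse inverse the class of $\Xi_{\delta,E,F}(U^*)$. -/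

import Mathlib

/-!
Coarse spaces, coarse geometric modules and approximating relations.

A relation `R ⊆ Y × X` from `X` to `Y` is a term `R : SetRel Y X`.  With Mathlib's conventions
`R.preimage A = {y | ∃ x ∈ A, (y, x) ∈ R}` is the set written `R(A)`,
`R₁.comp R₂ = {(z, x) | ∃ y, (z, y) ∈ R₁ ∧ (y, x) ∈ R₂}` is the composition written `R₁ ∘ R₂`, and
`R.inv` is the transpose of `R`.
-/

/-- A coarse structure on a set `X`; its members are the controlled entourages. -/
structure CoarseStructure (X : Type*) where
  entourages : Set (SetRel X X)
  mem_of_subset : ∀ E ∈ entourages, ∀ E' ⊆ E, E' ∈ entourages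
  union_mem : ∀ E ∈ entourages, ∀ E' ∈ entourages, E ∪ E' ∈ entourages
  id_mem : SetRel.id ∈ entourages
  inv_mem : ∀ E ∈ entourages, E.inv ∈ entourages
  comp_mem : ∀ E ∈ entourages, ∀ E' ∈ entourages, E.comp E' ∈ entourages

instance {X : Type*} : Membership (SetRel X X) (CoarseStructure X) where
  mem 𝓧 E := E ∈ 𝓧.entourages

/-- `A` is `E`-bounded: `A × A ⊆ E`. -/
def IsBddBy {X : Type*} (E : SetRel X X) (A : Set X) : Prop := A ×ˢ A ⊆ E

/-- `A'` is an `E`-controlled thickening of `A`: `A ⊆ A' ⊆ E(A)`. -/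
def IsThickening {X : Type*} (E : SetRel X X) (A A' : Set X) : Prop :=
  A ⊆ A' ∧ A' ⊆ E.preimage A

/-- The product relation `{((y, y'), (x, x')) | (y, x) ∈ R, (y', x') ∈ R'}`. -/
def prodRel {X Y X' Y' : Type*} (R : SetRel Y X) (R' : SetRel Y' X') :
    SetRel (Y × Y') (X × X') :=
  {p | (p.1.1, p.2.1) ∈ R ∧ (p.1.2, p.2.2) ∈ R'}

namespace CoarseStructure

/-- A gauge: a symmetric controlled entourage containing the diagonal. -/
def IsGauge {X : Type*} (𝓧 : CoarseStructure X) (E : SetRel X X) : Prop :=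
  E ∈ 𝓧 ∧ E.inv = E ∧ SetRel.id ⊆ E

/-- `A` is coarsely contained in `B`: it lies in a controlled thickening of `B`. -/
def CoarselySubset {X : Type*} (𝓧 : CoarseStructure X) (A B : Set X) : Prop :=
  ∃ E ∈ 𝓧, ∃ B', IsThickening E B B' ∧ A ⊆ B'

/-- `D` is coarsely dense: the whole space is coarsely contained in `D`. -/
def CoarselyDense {X : Type*} (𝓧 : CoarseStructure X) (D : Set X) : Prop :=
  𝓧.CoarselySubset Set.univ D

/-- The product coarse structure on `Y × X`: all relations contained in a product relation of a
controlled entourage of `Y` and one of `X`. -/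
def prod {X Y : Type*} (𝓨 : CoarseStructure Y) (𝓧 : CoarseStructure X) :
    CoarseStructure (Y × X) where
  entourages := {D | ∃ F ∈ 𝓨, ∃ E ∈ 𝓧, D ⊆ prodRel F E}
  mem_of_subset := by
    rintro D ⟨F, hF, E, hE, h⟩ D' h'
    exact ⟨F, hF, E, hE, h'.trans h⟩
  union_mem := by
    rintro D ⟨F, hF, E, hE, h⟩ D' ⟨F', hF', E', hE', h'⟩
    refine ⟨F ∪ F', 𝓨.union_mem _ hF _ hF', E ∪ E', 𝓧.union_mem _ hE _ hE', ?_⟩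
    rintro p (hp | hp)
    · exact ⟨Or.inl (h hp).1, Or.inl (h hp).2⟩
    · exact ⟨Or.inr (h' hp).1, Or.inr (h' hp).2⟩
  id_mem := by
    refine ⟨_, 𝓨.id_mem, _, 𝓧.id_mem, ?_⟩
    rintro ⟨a, b⟩ h
    obtain rfl : a = b := h
    exact ⟨rfl, rfl⟩
  inv_mem := by
    rintro D ⟨F, hF, E, hE, h⟩
    exact ⟨_, 𝓨.inv_mem _ hF, _, 𝓧.inv_mem _ hE, fun p hp => h hp⟩
  comp_mem := by
    rintro D ⟨F, hF, E, hE, h⟩ D' ⟨F', hF', E', hE', h'⟩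
    refine ⟨_, 𝓨.comp_mem _ hF _ hF', _, 𝓧.comp_mem _ hE _ hE', ?_⟩
    rintro ⟨a, c⟩ ⟨b, hab, hbc⟩
    exact ⟨⟨b.1, (h hab).1, (h' hbc).1⟩, ⟨b.2, (h hab).2, (h' hbc).2⟩⟩

end CoarseStructure

section CoarseMaps

variable {X Y Z : Type*}

/-- A relation `R` from `X` to `Y` is controlled if `(R ⊗ R)(E)` is a controlled entourage of `Y`
for every controlled entourage `E` of `X`. -/
def IsControlled (𝓧 : CoarseStructure X) (𝓨 : CoarseStructure Y) (R : SetRel Y X) : Prop :=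
  ∀ E ∈ 𝓧, (prodRel R R).preimage E ∈ 𝓨

/-- `R` (represents) a coarse map from `X` to `Y`: it is controlled and coarsely everywhere defined.
Coarse maps are classes of such relations up to `≍` (mutual coarse containment in `Y × X`). -/
def IsCoarseMap (𝓧 : CoarseStructure X) (𝓨 : CoarseStructure Y) (R : SetRel Y X) : Prop :=
  IsControlled 𝓧 𝓨 R ∧ 𝓧.CoarselyDense R.cod

/-- `[T]` is the coarse composition `[S] ∘ [R]`: the least coarse subspace of `Z × X` coarsely
containing `S' ∘ R'` for all `R'`, `S'` coarsely contained in `R`, `S` respectively. -/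
def IsCoarseComp (𝓧 : CoarseStructure X) (𝓨 : CoarseStructure Y) (𝓩 : CoarseStructure Z)
    (S : SetRel Z Y) (R : SetRel Y X) (T : SetRel Z X) : Prop :=
  (∀ (R' : SetRel Y X) (S' : SetRel Z Y),
      (𝓨.prod 𝓧).CoarselySubset R' R → (𝓩.prod 𝓨).CoarselySubset S' S →
      (𝓩.prod 𝓧).CoarselySubset (S'.comp R') T) ∧
    ∀ T' : SetRel Z X,
      (∀ (R' : SetRel Y X) (S' : SetRel Z Y),
        (𝓨.prod 𝓧).CoarselySubset R' R → (𝓩.prod 𝓨).CoarselySubset S' S →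
        (𝓩.prod 𝓧).CoarselySubset (S'.comp R') T') →
      (𝓩.prod 𝓧).CoarselySubset T T'

/-- `[R] : X → Y` is a coarse equivalence with coarse inverse `[S] : Y → X`: both are coarse maps,
and the coarse compositions `[S] ∘ [R]` and `[R] ∘ [S]` exist and equal the classes of the
diagonals. -/
def IsCoarseEquivWithInverse (𝓧 : CoarseStructure X) (𝓨 : CoarseStructure Y)
    (R : SetRel Y X) (S : SetRel X Y) : Prop :=
  IsCoarseMap 𝓧 𝓨 R ∧ IsCoarseMap 𝓨 𝓧 S ∧
    IsCoarseComp 𝓧 𝓨 𝓧 S R SetRel.id ∧ IsCoarseComp 𝓨 𝓧 𝓨 R S SetRel.id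

end CoarseMaps

/-- A (finitely additive) coarse geometric module for the coarse space `(X, 𝓧)` on the Hilbert space
`H`: a unital Boolean algebra of (measurable) subsets of `X`, with a non-degenerate unital
representation by projections.  The values of `χ` at non-measurable sets are irrelevant. -/
structure CoarseModule {X : Type*} (𝓧 : CoarseStructure X) (H : Type*) [NormedAddCommGroup H]
    [InnerProductSpace ℂ H] [CompleteSpace H] where
  meas : Set (Set X)
  univ_mem : Set.univ ∈ meas
  compl_mem : ∀ A ∈ meas, Aᶜ ∈ meas
  inter_mem : ∀ A ∈ meas, ∀ A' ∈ meas, A ∩ A' ∈ meas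
  χ : Set X → H →L[ℂ] H
  χ_proj : ∀ A ∈ meas, IsStarProjection (χ A)
  χ_inter : ∀ A ∈ meas, ∀ A' ∈ meas, χ (A' ∩ A) = (χ A').comp (χ A)
  χ_union : ∀ A ∈ meas, ∀ A' ∈ meas, Disjoint A A' → χ (A' ∪ A) = χ A' + χ A
  χ_univ : χ Set.univ = ContinuousLinearMap.id ℂ H
  nondegenerate : ∃ E, 𝓧.IsGauge E ∧
    Dense (Submodule.span ℂ {v : H | ∃ A ∈ meas, IsBddBy E A ∧ v ∈ Set.range (χ A)} : Set H)

namespace CoarseModule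

section Properties

variable {X : Type*} {𝓧 : CoarseStructure X} {H : Type*} [NormedAddCommGroup H]
  [InnerProductSpace ℂ H] [CompleteSpace H]

/-- There is a gauge such that every bounded subset has a measurable thickening controlled by it. -/
def IsLocallyAdmissible (M : CoarseModule 𝓧 H) : Prop :=
  ∃ G, 𝓧.IsGauge G ∧ ∀ A : Set X, (∃ E ∈ 𝓧, IsBddBy E A) → ∃ A' ∈ M.meas, IsThickening G A A'

/-- `M` is discrete: there is a controlled partition of `X` into measurable sets whose projections
sum strongly to the identity, and which detects measurability. -/
def IsDiscrete (M : CoarseModule 𝓧 H) : Prop :=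
  ∃ G, 𝓧.IsGauge G ∧ ∃ P : Set (Set X), Setoid.IsPartition P ∧
    (∀ A ∈ P, IsBddBy G A) ∧ (∀ A ∈ P, A ∈ M.meas) ∧
    (∀ v : H, HasSum (fun A : P => M.χ A v) v) ∧
    ∀ C : Set X, (∀ A ∈ P, C ∩ A ∈ M.meas) → C ∈ M.meas

/-- `M` is faithful (that is, `1`-ample): for some gauge `G`, the union of the measurable
`G`-bounded sets whose projection has rank at least one is coarsely dense. -/
def IsFaithful (M : CoarseModule 𝓧 H) : Prop :=
  ∃ G, 𝓧.IsGauge G ∧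
    𝓧.CoarselyDense (⋃₀ {A | A ∈ M.meas ∧ IsBddBy G A ∧ M.χ A ≠ 0})

/-- `t` has `E`-controlled propagation, i.e. `Supp t ⊆ E`: `χ_{A'} t χ_A = 0` for all measurable
`A, A'` such that `A'` is `E`-separated from `A`. -/
def HasPropagation (M : CoarseModule 𝓧 H) (E : SetRel X X) (t : H →L[ℂ] H) : Prop :=
  ∀ A ∈ M.meas, ∀ A' ∈ M.meas, A' ∩ E.preimage A = ∅ → (M.χ A').comp (t.comp (M.χ A)) = 0

/-- `t` is `ε`-`E`-quasi-local. -/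
def IsQuasiLocal (M : CoarseModule 𝓧 H) (ε : ℝ) (E : SetRel X X) (t : H →L[ℂ] H) : Prop :=
  ∀ A ∈ M.meas, ∀ A' ∈ M.meas, A' ∩ E.preimage A = ∅ →
    ‖(M.χ A').comp (t.comp (M.χ A))‖ ≤ ε

/-- A submodule of `M`: a closed subspace of `H` (closed and complete are the same thing here) that
is itself a coarse geometric module, with respect to a unital Boolean subalgebra of the measurable
sets and the restricted projections. -/
structure Sub (M : CoarseModule 𝓧 H) where
  carrier : Submodule ℂ H
  [complete : CompleteSpace carrier]
  toModule : CoarseModule 𝓧 carrier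
  meas_subset : toModule.meas ⊆ M.meas
  χ_eq : ∀ A ∈ toModule.meas, ∀ v : carrier, (toModule.χ A v : H) = M.χ A v

attribute [instance] Sub.complete

/-- `p ≤ q`: the submodule `p` is a submodule of `q`.  (Both restrict the projections of `M`, so the
projections of `p` are the restrictions of those of `q`.) -/
instance {M : CoarseModule 𝓧 H} : LE M.Sub where
  le p q := p.carrier ≤ q.carrier ∧ p.toModule.meas ⊆ q.toModule.meas

/-- The projection of `H` onto a submodule, as an operator on `H`. -/
noncomputable def Sub.proj {M : CoarseModule 𝓧 H} (p : M.Sub) : H →L[ℂ] H :=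
  p.carrier.starProjection

/-- The projection of `H` onto a submodule, as an operator `H → p(H)`. -/
noncomputable def Sub.corestrict {M : CoarseModule 𝓧 H} (p : M.Sub) : H →L[ℂ] p.carrier :=
  p.carrier.orthogonalProjectionOnto

/-- The inclusion `p(H) → H` of a submodule. -/
noncomputable def Sub.incl {M : CoarseModule 𝓧 H} (p : M.Sub) : p.carrier →L[ℂ] H :=
  p.carrier.subtypeL

end Properties

section Operators

variable {X Y : Type*} {𝓧 : CoarseStructure X} {𝓨 : CoarseStructure Y}
  {HX : Type*} [NormedAddCommGroup HX] [InnerProductSpace ℂ HX] [CompleteSpace HX]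
  {HY : Type*} [NormedAddCommGroup HY] [InnerProductSpace ℂ HY] [CompleteSpace HY]

/-- The conjugation `Ad(T) : t ↦ T t T*`. -/
noncomputable def Ad (T : HX →L[ℂ] HY) (t : HX →L[ℂ] HX) : HY →L[ℂ] HY :=
  T.comp (t.comp (ContinuousLinearMap.adjoint T))

/-- A mapping `φ` between the bounded operators is quasi-controlled. -/
def IsQuasiControlled (MX : CoarseModule 𝓧 HX) (MY : CoarseModule 𝓨 HY)
    (φ : (HX →L[ℂ] HX) → (HY →L[ℂ] HY)) : Prop :=
  ∀ E ∈ 𝓧, ∀ ε : ℝ, 0 < ε → ∃ F ∈ 𝓨, ∀ t : HX →L[ℂ] HX, MX.HasPropagation E t →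
    MY.IsQuasiLocal (ε * ‖t‖) F (φ t)

/-- `T` is weakly quasi-controlled: `Ad(T)` is quasi-controlled. -/
def IsWeaklyQuasiControlled (MX : CoarseModule 𝓧 HX) (MY : CoarseModule 𝓨 HY)
    (T : HX →L[ℂ] HY) : Prop :=
  IsQuasiControlled MX MY (Ad T)

/-- The approximating relation from `X` to `Y` of `T` with parameters `δ, F, E`: the union of all
`B × A` with `B`, `A` measurable, `B` being `F`-bounded, `A` being `E`-bounded, and
`‖χ_B T χ_A‖ > δ`. -/
def approxRel (MX : CoarseModule 𝓧 HX) (MY : CoarseModule 𝓨 HY) (T : HX →L[ℂ] HY)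
    (δ : ℝ) (F : SetRel Y Y) (E : SetRel X X) : SetRel Y X :=
  {p | ∃ B ∈ MY.meas, ∃ A ∈ MX.meas, IsBddBy F B ∧ IsBddBy E A ∧
    δ < ‖(MY.χ B).comp (T.comp (MX.χ A))‖ ∧ p.1 ∈ B ∧ p.2 ∈ A}

end Operators

end CoarseModule

/-! A relation `R` whose transpose is also controlled, and whose domain and codomain are both
coarsely dense, is a coarse equivalence with inverse `R.inv` (`isCoarseEquivWithInverse_inv`).
Transposing an approximating relation amounts to passing to the adjoint operator, so control and
density need proof in one direction only and are then applied to `T` and to `T*`.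

Control (`isControlled_approxRel`): two related pairs over nearby points of `X` yield vectors `v`,
`u` with nearby supports, and `Ad(T)` sends the rank one operator `v ⊗ u*` to `Tv ⊗ (Tu)*`.
Quasi-locality of the latter forces the two pieces of `Y` to be close.

Density (`coarselyDense_cod_approxRel`) rests on `exists_concentration`: if `v` has bounded support,
`Tv` lives on a bounded set up to a small error. Cut `w = q₁Tv` along the discrete partition. Every
partial sum of pieces is mapped by `T*` almost into a neighbourhood `A'` of the support of `v`,
because `T*` is quasi-controlled. The sign choice lemma `sum_norm_sq_le_of_norm_sum_le` makes the
errors square summable, so some nonzero piece `wᵢ` has a small relative error. Then `u = χ_{A'} p₂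
T* wᵢ` is supported near `v`, while `Tu` is visible on the `i`-th piece. Quasi-locality of `Tv ⊗
(Tu)*` now confines `Tv` to a neighbourhood of that piece. -/

/-! ### Coarse containment. -/

namespace CoarseStructure

variable {X Y : Type*} {𝓧 : CoarseStructure X} {𝓨 : CoarseStructure Y}

/-- Adding the diagonal to `E` turns `E(B)` into a thickening of `B`. -/
theorem coarselySubset_iff {A B : Set X} :
    𝓧.CoarselySubset A B ↔ ∃ E ∈ 𝓧, A ⊆ E.preimage B := by
  constructor
  · rintro ⟨E, hE, B', hB', hA⟩
    exact ⟨E, hE, hA.trans hB'.2⟩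
  · rintro ⟨E, hE, hA⟩
    refine ⟨E ∪ SetRel.id, 𝓧.union_mem _ hE _ 𝓧.id_mem, (E ∪ SetRel.id).preimage B,
      ⟨fun x hx => ⟨x, hx, Or.inr rfl⟩, subset_rfl⟩, fun x hx => ?_⟩
    obtain ⟨b, hb, h⟩ := hA hx
    exact ⟨b, hb, Or.inl h⟩

theorem CoarselySubset.of_subset {A B : Set X} (h : A ⊆ B) : 𝓧.CoarselySubset A B :=
  coarselySubset_iff.2 ⟨_, 𝓧.id_mem, fun x hx => ⟨x, h hx, rfl⟩⟩

theorem CoarselySubset.trans {A B C : Set X} (h : 𝓧.CoarselySubset A B)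
    (h' : 𝓧.CoarselySubset B C) : 𝓧.CoarselySubset A C := by
  obtain ⟨E, hE, hAB⟩ := coarselySubset_iff.1 h
  obtain ⟨E', hE', hBC⟩ := coarselySubset_iff.1 h'
  refine coarselySubset_iff.2 ⟨_, 𝓧.comp_mem _ hE _ hE', fun x hx => ?_⟩
  obtain ⟨b, hb, hxb⟩ := hAB hx
  obtain ⟨c, hc, hbc⟩ := hBC hb
  exact ⟨c, hc, b, hxb, hbc⟩

theorem CoarselyDense.mono {D D' : Set X} (h : 𝓧.CoarselyDense D) (hD : D ⊆ D') :
    𝓧.CoarselyDense D' :=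
  CoarselySubset.trans h (.of_subset hD)

end CoarseStructure

/-! ### Coarse equivalences inverted by their transpose. -/

section CoarseMaps

open CoarseStructure

variable {X Y : Type*} {𝓧 : CoarseStructure X} {𝓨 : CoarseStructure Y}

theorem IsControlled.mono {R R' : SetRel Y X} (h : IsControlled 𝓧 𝓨 R) (hR : R' ⊆ R) :
    IsControlled 𝓧 𝓨 R' := fun E hE =>
  𝓨.mem_of_subset _ (h E hE) _ fun _ ⟨q, hq, h1, h2⟩ => ⟨q, hq, hR h1, hR h2⟩

/-- If the transpose of a coarsely everywhere defined relation is controlled, then it is a left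
inverse of the relation. -/
theorem isCoarseComp_inv_id {R : SetRel Y X} (h : IsControlled 𝓨 𝓧 R.inv)
    (hd : 𝓧.CoarselyDense R.cod) : IsCoarseComp 𝓧 𝓨 𝓧 R.inv R SetRel.id := by
  constructor
  · intro R' S' hR' hS'
    obtain ⟨D, ⟨F, hF, E, hE, hD⟩, hR'⟩ := coarselySubset_iff.1 hR'
    obtain ⟨D', ⟨E₂, hE₂, F₂, hF₂, hD'⟩, hS'⟩ := coarselySubset_iff.1 hS'
    -- Both approximating pairs lie near the same middle point `y`, so their `Y`-coordinates are
    -- related by `F₂⁻¹ ∘ F`; control of the transpose carries this to `X`.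
    have hW := h _ (𝓨.comp_mem _ (𝓨.inv_mem _ hF₂) _ hF)
    refine coarselySubset_iff.2 ⟨prodRel _ _,
      ⟨_, 𝓧.comp_mem _ hE₂ _ (𝓧.comp_mem _ hW _ (𝓧.inv_mem _ hE)), _, 𝓧.id_mem, subset_rfl⟩, ?_⟩
    rintro ⟨x', x⟩ ⟨y, hx', hx⟩
    obtain ⟨⟨y₀, x₀⟩, h₀, hd₀⟩ := hR' hx
    obtain ⟨⟨x₁, y₁⟩, h₁, hd₁⟩ := hS' hx'
    have k₀ := hD hd₀
    have k₁ := hD' hd₁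
    exact ⟨(x, x), rfl, ⟨x₁, k₁.1, x₀, ⟨(y₁, y₀), ⟨y, k₁.2, k₀.1⟩, h₁, h₀⟩, k₀.2⟩, rfl⟩
  · intro T' hT'
    -- Minimality: `R.inv ∘ R` contains the diagonal over `R.cod`, which is coarsely dense.
    refine CoarselySubset.trans ?_ (hT' R R.inv (.of_subset subset_rfl) (.of_subset subset_rfl))
    obtain ⟨E, hE, hd⟩ := coarselySubset_iff.1 hd
    refine coarselySubset_iff.2 ⟨prodRel E E, ⟨E, hE, E, hE, subset_rfl⟩, ?_⟩
    rintro ⟨x, x'⟩ hx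
    obtain rfl : x = x' := hx
    obtain ⟨x₀, ⟨y, hy⟩, hx₀⟩ := hd (Set.mem_univ x)
    exact ⟨(x₀, x₀), ⟨y, hy, hy⟩, hx₀, hx₀⟩

theorem isCoarseEquivWithInverse_inv {R : SetRel Y X} (h : IsControlled 𝓧 𝓨 R)
    (h' : IsControlled 𝓨 𝓧 R.inv) (hd : 𝓧.CoarselyDense R.cod) (hd' : 𝓨.CoarselyDense R.dom) :
    IsCoarseEquivWithInverse 𝓧 𝓨 R R.inv :=
  ⟨⟨h, hd⟩, ⟨h', hd'⟩, isCoarseComp_inv_id h' hd,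
    isCoarseComp_inv_id (R := R.inv) h hd'⟩

end CoarseMaps

/-! ### A sign choice in Hilbert space. -/

/-- If all partial sums of finitely many vectors have norm at most `c`, then their squared norms
sum to at most `(2c)²`. -/
theorem sum_norm_sq_le_of_norm_sum_le {ι H : Type*} [NormedAddCommGroup H]
    [InnerProductSpace ℂ H] (s : Finset ι) (x : ι → H) {c : ℝ}
    (h : ∀ J ⊆ s, ‖∑ i ∈ J, x i‖ ≤ c) : ∑ i ∈ s, ‖x i‖ ^ 2 ≤ (2 * c) ^ 2 := by
  classical
  -- `J` is the set of plus signs. By the parallelogram law, one of the two signs for each new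
  -- vector raises the squared norm by at least that of the vector.
  have key : ∀ s : Finset ι, ∃ J ⊆ s,
      ∑ i ∈ s, ‖x i‖ ^ 2 ≤ ‖∑ i ∈ J, x i - ∑ i ∈ s \ J, x i‖ ^ 2 := by
    intro s
    induction s using Finset.induction_on with
    | empty => exact ⟨∅, subset_rfl, by simp⟩
    | insert a s ha ih =>
      obtain ⟨J, hJ, hs⟩ := ih
      have haJ : a ∉ J := fun h => ha (hJ h)
      set z := ∑ i ∈ J, x i - ∑ i ∈ s \ J, x i with hz
      have hp := parallelogram_law_with_norm ℂ z (x a)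
      have h1 : ∑ i ∈ insert a J, x i - ∑ i ∈ insert a s \ insert a J, x i = z + x a := by
        rw [Finset.sum_insert haJ, Finset.insert_sdiff_insert, Finset.sdiff_insert,
          Finset.erase_eq_of_notMem (by simp [ha]), hz]
        abel
      have h2 : ∑ i ∈ J, x i - ∑ i ∈ insert a s \ J, x i = z - x a := by
        rw [Finset.insert_sdiff_of_notMem _ haJ, Finset.sum_insert (by simp [ha]), hz]
        abel
      rw [Finset.sum_insert ha]
      by_cases hc : ‖z‖ ^ 2 + ‖x a‖ ^ 2 ≤ ‖z + x a‖ ^ 2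
      · exact ⟨insert a J, Finset.insert_subset_insert _ hJ, by rw [h1]; linarith⟩
      · exact ⟨J, hJ.trans (Finset.subset_insert _ _), by rw [h2]; nlinarith⟩
  obtain ⟨J, hJ, hs⟩ := key s
  refine hs.trans (pow_le_pow_left₀ (norm_nonneg _) ((norm_sub_le _ _).trans ?_) 2)
  linarith [h J hJ, h (s \ J) Finset.sdiff_subset]

/-! ### Measurable sets, their projections and submodules. -/

namespace CoarseModule

section Basic

variable {X : Type*} {𝓧 : CoarseStructure X} {H : Type*} [NormedAddCommGroup H]
  [InnerProductSpace ℂ H] [CompleteSpace H] (M : CoarseModule 𝓧 H)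

theorem empty_mem : ∅ ∈ M.meas := by
  simpa using M.compl_mem _ M.univ_mem

variable {M} {A B : Set X}

theorem union_mem (hA : A ∈ M.meas) (hB : B ∈ M.meas) : A ∪ B ∈ M.meas := by
  have := M.compl_mem _ (M.inter_mem _ (M.compl_mem _ hA) _ (M.compl_mem _ hB))
  rwa [Set.compl_inter, compl_compl, compl_compl] at this

theorem biUnion_mem {ι : Type*} {J : Finset ι} {B : ι → Set X} (h : ∀ i ∈ J, B i ∈ M.meas) :
    (⋃ i ∈ J, B i) ∈ M.meas := by
  classical
  induction J using Finset.induction_on with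
  | empty => simpa using M.empty_mem
  | insert a s ha ih =>
    rw [Finset.set_biUnion_insert]
    exact union_mem (h _ (Finset.mem_insert_self _ _))
      (ih fun i hi => h i (Finset.mem_insert_of_mem hi))

variable (M) in
theorem chi_empty : M.χ ∅ = 0 := by
  have := M.χ_union _ M.empty_mem _ M.empty_mem (by simp)
  simpa using this

theorem chi_inter_apply (hA : A ∈ M.meas) (hB : B ∈ M.meas) (v : H) :
    M.χ A (M.χ B v) = M.χ (A ∩ B) v := by
  rw [M.χ_inter _ hB _ hA]; rfl

theorem chi_chi_of_subset (hA : A ∈ M.meas) (hB : B ∈ M.meas) (h : A ⊆ B) (v : H) :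
    M.χ B (M.χ A v) = M.χ A v := by
  rw [chi_inter_apply hB hA, Set.inter_eq_right.2 h]

theorem chi_chi_of_subset' (hA : A ∈ M.meas) (hB : B ∈ M.meas) (h : A ⊆ B) (v : H) :
    M.χ A (M.χ B v) = M.χ A v := by
  rw [chi_inter_apply hA hB, Set.inter_eq_left.2 h]

theorem chi_chi_of_disjoint (hA : A ∈ M.meas) (hB : B ∈ M.meas) (h : A ∩ B = ∅) (v : H) :
    M.χ A (M.χ B v) = 0 := by
  rw [chi_inter_apply hA hB, h, M.chi_empty]; rfl

theorem chi_add_chi_compl (hA : A ∈ M.meas) (v : H) : M.χ A v + M.χ Aᶜ v = v := by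
  have := M.χ_union _ (M.compl_mem _ hA) _ hA disjoint_compl_left
  rw [Set.union_compl_self, M.χ_univ] at this
  exact (DFunLike.congr_fun this v).symm

theorem adjoint_chi (hA : A ∈ M.meas) : ContinuousLinearMap.adjoint (M.χ A) = M.χ A :=
  (M.χ_proj A hA).isSelfAdjoint

theorem inner_chi (hA : A ∈ M.meas) (v w : H) :
    inner ℂ (M.χ A v) w = inner ℂ v (M.χ A w) := by
  rw [← ContinuousLinearMap.adjoint_inner_left, adjoint_chi hA]

theorem opNorm_chi_le (hA : A ∈ M.meas) : ‖M.χ A‖ ≤ 1 :=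
  (M.χ_proj A hA).norm_le

theorem norm_chi_apply_le (hA : A ∈ M.meas) (v : H) : ‖M.χ A v‖ ≤ ‖v‖ := by
  simpa using (M.χ A).le_of_opNorm_le (opNorm_chi_le hA) v

theorem chi_biUnion_apply {ι : Type*} {J : Finset ι} {B : ι → Set X}
    (h : ∀ i ∈ J, B i ∈ M.meas) (hd : (J : Set ι).PairwiseDisjoint B) (v : H) :
    M.χ (⋃ i ∈ J, B i) v = ∑ i ∈ J, M.χ (B i) v := by
  classical
  induction J using Finset.induction_on with
  | empty => simp [M.chi_empty]
  | insert a s ha ih =>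
    have hs : ∀ i ∈ s, B i ∈ M.meas := fun i hi => h i (Finset.mem_insert_of_mem hi)
    rw [Finset.set_biUnion_insert, Finset.sum_insert ha, ← ih hs
      (hd.subset (by simp)), M.χ_union _ (biUnion_mem hs) _ (h _ (Finset.mem_insert_self _ _))]
    · rfl
    · refine Set.disjoint_iUnion₂_left.2 fun i hi => hd (by simp [hi]) (by simp) ?_
      rintro rfl
      exact ha hi

/-- The measurable sets of a discrete module contain uniformly controlled hulls of all subsets. -/
theorem IsDiscrete.exists_thickening (h : M.IsDiscrete) :
    ∃ G ∈ 𝓧, ∀ S : Set X, ∃ S' ∈ M.meas, S ⊆ S' ∧ S' ⊆ G.preimage S := by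
  obtain ⟨G, hG, P, hP, hPG, hPm, -, hC⟩ := h
  refine ⟨G, hG.1, fun S => ?_⟩
  -- The union of the pieces meeting `S` cuts each piece in itself or in `∅`, so it is measurable
  -- even when `S` is unbounded.
  refine ⟨⋃₀ {A | A ∈ P ∧ (A ∩ S).Nonempty}, hC _ fun A hA => ?_, ?_, ?_⟩
  · by_cases hAS : (A ∩ S).Nonempty
    · have hsub : A ⊆ ⋃₀ {A | A ∈ P ∧ (A ∩ S).Nonempty} := Set.subset_sUnion_of_mem ⟨hA, hAS⟩
      rw [Set.inter_eq_right.2 hsub]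
      exact hPm A hA
    · have : ⋃₀ {A | A ∈ P ∧ (A ∩ S).Nonempty} ∩ A = ∅ := by
        refine Set.eq_empty_of_forall_notMem ?_
        rintro x ⟨⟨B, ⟨hB, hBS⟩, hxB⟩, hxA⟩
        have : A = B := (hP.2 x).unique ⟨hA, hxA⟩ ⟨hB, hxB⟩
        exact hAS (this ▸ hBS)
      rw [this]
      exact M.empty_mem
  · intro x hx
    obtain ⟨A, ⟨hA, hxA⟩, -⟩ := hP.2 x
    exact ⟨A, ⟨hA, x, hxA, hx⟩, hxA⟩
  · rintro x ⟨A, ⟨hA, y, hyA, hyS⟩, hxA⟩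
    exact ⟨y, hyS, hPG A hA ⟨hxA, hyA⟩⟩

/-- Rank one operators are the test operators that extract information on single vectors from
quasi-control. -/
theorem hasPropagation_rankOne {D : SetRel X X} (hA : A ∈ M.meas) (hB : B ∈ M.meas)
    (hD : A ×ˢ B ⊆ D) {v u : H} (hv : M.χ A v = v) (hu : M.χ B u = u) :
    M.HasPropagation D (InnerProductSpace.rankOne ℂ v u) := by
  intro C hC C' hC' hCC'
  ext x
  simp only [ContinuousLinearMap.comp_apply, InnerProductSpace.rankOne_apply, map_smul,
    zero_apply]
  by_cases h₁ : C' ∩ A = ∅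
  · rw [← hv, chi_chi_of_disjoint hC' hA h₁, smul_zero]
  by_cases h₂ : B ∩ C = ∅
  · rw [← hu, inner_chi hB, chi_chi_of_disjoint hB hC h₂, inner_zero_right, zero_smul]
  obtain ⟨a, haC, haA⟩ := Set.nonempty_iff_ne_empty.2 h₁
  obtain ⟨b, hbB, hbC⟩ := Set.nonempty_iff_ne_empty.2 h₂
  exact absurd hCC' (Set.nonempty_iff_ne_empty.1 ⟨a, haC, b, hbC, hD ⟨haA, hbB⟩⟩)

namespace Sub

variable {p q : M.Sub}

theorem chi_mem (hA : A ∈ p.toModule.meas) {v : H} (hv : v ∈ p.carrier) :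
    M.χ A v ∈ p.carrier := by
  rw [← p.χ_eq A hA ⟨v, hv⟩]
  exact Subtype.property _

theorem proj_mem (v : H) : p.proj v ∈ p.carrier :=
  Submodule.starProjection_apply_mem _ _

theorem proj_eq {v : H} (hv : v ∈ p.carrier) : p.proj v = v :=
  Submodule.starProjection_eq_self_iff.2 hv

theorem norm_proj_apply_le (v : H) : ‖p.proj v‖ ≤ ‖v‖ :=
  Submodule.norm_starProjection_apply_le _ _

theorem coe_corestrict (v : H) : (p.corestrict v : H) = p.proj v := rfl

theorem inner_proj (v w : H) : inner ℂ (p.proj v) w = inner ℂ v (p.proj w) :=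
  Submodule.inner_starProjection_left_eq_right _ _ _

theorem adjoint_proj : ContinuousLinearMap.adjoint p.proj = p.proj :=
  ((ContinuousLinearMap.eq_adjoint_iff _ _).2 inner_proj).symm

theorem adjoint_incl : ContinuousLinearMap.adjoint p.incl = p.corestrict :=
  Submodule.adjoint_subtypeL _

theorem adjoint_corestrict : ContinuousLinearMap.adjoint p.corestrict = p.incl :=
  Submodule.adjoint_orthogonalProjectionOnto _

/-- A self-adjoint operator preserving a closed subspace commutes with the projection onto it. This
requires `A` to be measurable for `p`, which is why sets are later replaced by hulls. -/
theorem proj_chi (hA : A ∈ p.toModule.meas) (v : H) : p.proj (M.χ A v) = M.χ A (p.proj v) := by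
  refine Submodule.eq_starProjection_of_mem_of_inner_eq_zero (chi_mem hA (proj_mem v)) ?_
  intro w hw
  rw [← map_sub, inner_chi (p.meas_subset hA)]
  exact Submodule.starProjection_inner_eq_zero _ _ (chi_mem hA hw)

end Sub

end Basic

open ContinuousLinearMap (adjoint adjoint_adjoint adjoint_inner_right)

section Chi

variable {X : Type*} {𝓧 : CoarseStructure X} {H : Type*} [NormedAddCommGroup H]
  [InnerProductSpace ℂ H] [CompleteSpace H] {M : CoarseModule 𝓧 H}

theorem inner_chi_self {A : Set X} (hA : A ∈ M.meas) (v : H) :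
    inner ℂ (M.χ A v) v = (‖M.χ A v‖ : ℂ) ^ 2 := by
  rw [← chi_chi_of_subset hA hA subset_rfl, inner_chi hA, inner_self_eq_norm_sq_to_K,
    chi_chi_of_subset hA hA subset_rfl]
  rfl

theorem norm_sum_chi_sq {ι : Type*} {J : Finset ι} {B : ι → Set X}
    (h : ∀ i ∈ J, B i ∈ M.meas) (hd : (J : Set ι).PairwiseDisjoint B) (v : H) :
    ‖∑ i ∈ J, M.χ (B i) v‖ ^ 2 = ∑ i ∈ J, ‖M.χ (B i) v‖ ^ 2 := by
  have h1 := inner_chi_self (biUnion_mem h) v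
  rw [chi_biUnion_apply h hd, sum_inner, Finset.sum_congr rfl fun i hi => inner_chi_self (h i hi) v]
    at h1
  exact_mod_cast h1.symm

theorem Sub.proj_proj_of_le {p q : M.Sub} (h : p ≤ q) (v : H) : p.proj (q.proj v) = p.proj v :=
  DFunLike.congr_fun (Submodule.starProjection_comp_starProjection_of_le h.1) v

end Chi

/-! ### Concentration of images of boundedly supported vectors. -/

section Operators

variable {X Y : Type*} {𝓧 : CoarseStructure X} {𝓨 : CoarseStructure Y}
  {HX : Type*} [NormedAddCommGroup HX] [InnerProductSpace ℂ HX] [CompleteSpace HX]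
  {HY : Type*} [NormedAddCommGroup HY] [InnerProductSpace ℂ HY] [CompleteSpace HY]
  {MX : CoarseModule 𝓧 HX} {MY : CoarseModule 𝓨 HY}

/-- `Ad(T)` maps `v ⊗ u*` to `Tv ⊗ (Tu)*`, and the norm of a rank one operator is the product of the
norms of its vectors. -/
theorem norm_chi_mul_norm_chi_le {T : HX →L[ℂ] HY} {D : SetRel X X} {F : SetRel Y Y} {ε : ℝ}
    (h : ∀ t : HX →L[ℂ] HX, MX.HasPropagation D t → MY.IsQuasiLocal (ε * ‖t‖) F (Ad T t))
    {A A' : Set X} (hA : A ∈ MX.meas) (hA' : A' ∈ MX.meas) (hD : A ×ˢ A' ⊆ D)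
    {B B' : Set Y} (hB : B ∈ MY.meas) (hB' : B' ∈ MY.meas) (hF : B ∩ F.preimage B' = ∅)
    {v u : HX} (hv : MX.χ A v = v) (hu : MX.χ A' u = u) :
    ‖MY.χ B (T v)‖ * ‖MY.χ B' (T u)‖ ≤ ε * (‖v‖ * ‖u‖) := by
  have h1 := h _ (hasPropagation_rankOne hA hA' hD hv hu) B' hB' B hB hF
  have h2 : (MY.χ B).comp ((Ad T (InnerProductSpace.rankOne ℂ v u)).comp (MY.χ B')) =
      InnerProductSpace.rankOne ℂ (MY.χ B (T v)) (MY.χ B' (T u)) := by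
    ext x
    simp [Ad, adjoint_inner_right, inner_chi hB']
  rwa [h2, InnerProductSpace.norm_rankOne, InnerProductSpace.norm_rankOne] at h1

/-- The bound does not depend on `J`: with `U` the union of the pieces, `χ_U q₁` is a contraction
that is block diagonal along them, hence of `G`-controlled propagation although `U` may be
unbounded. -/
theorem norm_sum_chi_adjoint_le {q₁ q₂ : MY.Sub} (hq : q₁ ≤ q₂) {T : HX →L[ℂ] HY}
    {G : SetRel Y Y} {E : SetRel X X} {ε : ℝ} (hε : 0 ≤ ε)
    (h : ∀ t : q₂.carrier →L[ℂ] q₂.carrier, q₂.toModule.HasPropagation G t →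
      MX.IsQuasiLocal (ε * ‖t‖) E (Ad ((adjoint T).comp q₂.incl) t))
    {ι : Type*} {J : Finset ι} {B : ι → Set Y} (hB : ∀ i ∈ J, B i ∈ q₁.toModule.meas)
    (hBG : ∀ i ∈ J, IsBddBy G (B i)) (hd : (J : Set ι).PairwiseDisjoint B)
    {A A' : Set X} (hA : A ∈ MX.meas) (hA' : A' ∈ MX.meas) (hAA' : A' ∩ E.preimage A = ∅)
    {v : HX} (hv : MX.χ A v = v) :
    ‖∑ i ∈ J, MX.χ A' (adjoint T (MY.χ (B i) (q₁.proj (T v))))‖ ≤ ε * ‖v‖ := by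
  have hB₂ : ∀ i ∈ J, B i ∈ q₂.toModule.meas := fun i hi => hq.2 (hB i hi)
  have hBY : ∀ i ∈ J, B i ∈ MY.meas := fun i hi => q₂.meas_subset (hB₂ i hi)
  have hU := biUnion_mem hB₂
  set U := ⋃ i ∈ J, B i with hUdef
  set t : q₂.carrier →L[ℂ] q₂.carrier :=
    (q₂.toModule.χ U).comp (q₂.corestrict.comp (q₁.proj.comp q₂.incl)) with ht
  have ht_apply : ∀ x : q₂.carrier, (t x : HY) = MY.χ U (q₁.proj x) := by
    intro x
    change ((q₂.toModule.χ U (q₂.corestrict (q₁.proj (x : HY))) : q₂.carrier) : HY) = _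
    rw [q₂.χ_eq U hU, Sub.coe_corestrict, Sub.proj_eq (hq.1 (Sub.proj_mem _))]
  have ht_norm : ‖t‖ ≤ 1 := by
    refine ContinuousLinearMap.opNorm_le_bound _ zero_le_one fun x => ?_
    rw [one_mul, ← Submodule.norm_coe, ht_apply, ← Submodule.norm_coe x]
    exact (norm_chi_apply_le (q₂.meas_subset hU) _).trans (Sub.norm_proj_apply_le _)
  have ht_prop : q₂.toModule.HasPropagation G t := by
    intro C hC C' hC' hCC'
    ext x
    change ((q₂.toModule.χ C' (t (q₂.toModule.χ C x)) : q₂.carrier) : HY) = 0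
    rw [q₂.χ_eq C' hC', ht_apply, q₂.χ_eq C hC, chi_biUnion_apply hBY hd, map_sum]
    refine Finset.sum_eq_zero fun i hi => ?_
    have hCY := q₂.meas_subset hC
    have hCY' := q₂.meas_subset hC'
    by_cases h₁ : C' ∩ B i = ∅
    · exact chi_chi_of_disjoint hCY' (hBY i hi) h₁ _
    by_cases h₂ : B i ∩ C = ∅
    -- `q₁` need not commute with `χ_C`, but it commutes with `χ_{Bᵢ}`.
    · rw [← Sub.proj_chi (hB i hi), chi_chi_of_disjoint (hBY i hi) hCY h₂, map_zero, map_zero]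
    obtain ⟨b', hb'C, hb'B⟩ := Set.nonempty_iff_ne_empty.2 h₁
    obtain ⟨b, hbB, hbC⟩ := Set.nonempty_iff_ne_empty.2 h₂
    exact absurd hCC' (Set.nonempty_iff_ne_empty.1 ⟨b', hb'C, b, hbC, hBG i hi ⟨hb'B, hbB⟩⟩)
  have h1 := h t ht_prop A hA A' hA' hAA'
  have h2 : (MX.χ A').comp ((Ad ((adjoint T).comp q₂.incl) t).comp (MX.χ A)) v =
      ∑ i ∈ J, MX.χ A' (adjoint T (MY.χ (B i) (q₁.proj (T v)))) := by
    rw [Ad, ContinuousLinearMap.adjoint_comp, Sub.adjoint_incl, adjoint_adjoint]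
    change MX.χ A' (adjoint T (t (q₂.corestrict (T (MX.χ A v))))) = _
    rw [hv, ht_apply, Sub.coe_corestrict, Sub.proj_proj_of_le hq, chi_biUnion_apply hBY hd,
      map_sum, map_sum]
  rw [← h2]
  refine (ContinuousLinearMap.le_of_opNorm_le _ h1 v).trans ?_
  gcongr
  exact mul_le_of_le_one_right hε ht_norm

/-- The concentration inequality: images of vectors of bounded support are uniformly concentrated
on bounded sets. -/
theorem exists_concentration {T : HX →L[ℂ] HY} {μ η : ℝ} (hμη : μ < η)
    {p₀ p₁ p₂ : MX.Sub} {q₁ q₂ : MY.Sub} (hp₀ : p₀ ≤ p₁) (hp : p₁ ≤ p₂) (hq : q₁ ≤ q₂)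
    (h₁ : ∀ v ∈ p₀.carrier, ‖q₁.proj (T v) - T v‖ ≤ μ * ‖v‖)
    (h₂ : ∀ w ∈ q₁.carrier, ‖p₂.proj (adjoint T w) - adjoint T w‖ ≤ μ * ‖w‖)
    (hpd : p₁.toModule.IsDiscrete) (hqd : q₁.toModule.IsDiscrete)
    (hη : ∀ v ∈ p₀.carrier, η * ‖v‖ ≤ ‖T v‖)
    (hη' : ∀ w ∈ q₁.carrier, η * ‖w‖ ≤ ‖adjoint T w‖)
    (hw : IsWeaklyQuasiControlled p₂.toModule MY (T.comp p₂.incl))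
    (hw' : IsWeaklyQuasiControlled q₂.toModule MX ((adjoint T).comp q₂.incl))
    {E : SetRel X X} (hE : E ∈ 𝓧) {ε : ℝ} (hε : 0 < ε) :
    ∃ F ∈ 𝓨, ∀ A ∈ p₀.toModule.meas, IsBddBy E A → ∀ v ∈ p₀.carrier, MX.χ A v = v → v ≠ 0 →
      ∃ B ∈ q₁.toModule.meas, IsBddBy F B ∧ ‖MY.χ Bᶜ (T v)‖ ≤ ε * ‖v‖ := by
  obtain ⟨Gp, hGp, hullp⟩ := hpd.exists_thickening
  obtain ⟨Gq, hGq, hullq⟩ := hqd.exists_thickening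
  obtain ⟨G, hG, P, hP, hPG, hPm, hPsum, -⟩ := hqd
  have hκ : 0 < η - μ := sub_pos.2 hμη
  set κ := η - μ with hκdef
  set N := ‖T‖ + 1 with hN
  have hN0 : 0 < N := by positivity
  have hTN : ‖T‖ ≤ N := by simp [hN]
  -- Chosen so that `N * ε' = κ ^ 2 / 2`: the error then costs at most half of the lower bound `κ ^
  -- 2` for `‖z‖ ^ 2 / ‖wi‖ ^ 2`.
  set ε' := κ ^ 2 / (2 * N) with hε'
  have hε'0 : 0 < ε' := by positivity
  -- The sign choice lemma doubles this tolerance to `ε' * (κ / 2)`, matching the mass `κ / 2 * ‖v‖`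
  -- captured by finitely many pieces.
  obtain ⟨E', hE', hloc⟩ := hw' G hG.1 (ε' * κ / 4) (by positivity)
  obtain ⟨F', hF', hloc'⟩ := hw _ (𝓧.inv_mem _ (𝓧.comp_mem _ (𝓧.comp_mem _ hGp _ hE') _ hE))
    (ε * (κ ^ 2 / 2) / N) (by positivity)
  set K := (Gq.comp F').comp G with hK
  have hKm : K ∈ 𝓨 := 𝓨.comp_mem _ (𝓨.comp_mem _ hGq _ hF') _ hG.1
  refine ⟨K.comp K.inv, 𝓨.comp_mem _ hKm _ (𝓨.inv_mem _ hKm), fun A hA hAE v hv hAv hv0 => ?_⟩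
  have hvpos : 0 < ‖v‖ := norm_pos_iff.2 hv0
  have hA₂ : A ∈ p₂.toModule.meas := hp.2 (hp₀.2 hA)
  have hAX : A ∈ MX.meas := p₂.meas_subset hA₂
  obtain ⟨A', hA'₁, hA'sub, hA'hull⟩ := hullp (E'.preimage A)
  have hA'₂ : A' ∈ p₂.toModule.meas := hp.2 hA'₁
  have hA'X : A' ∈ MX.meas := p₂.meas_subset hA'₂
  have hA'c := MX.compl_mem _ hA'X
  set w := q₁.proj (T v) with hwdef
  have hwmem : w ∈ q₁.carrier := Sub.proj_mem _
  have hwnorm : κ * ‖v‖ ≤ ‖w‖ := by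
    have := norm_sub_norm_le (T v) w
    rw [norm_sub_rev] at this
    linarith [h₁ v hv, hη v hv]
  have hPY : ∀ i : P, (i : Set Y) ∈ MY.meas := fun i => q₁.meas_subset (hPm i i.2)
  have hdisj : Pairwise (Function.onFun Disjoint fun i : P => (i : Set Y)) := by
    intro i j hij
    exact hP.pairwiseDisjoint i.2 j.2 (Subtype.coe_ne_coe.2 hij)
  have hsum : HasSum (fun i : P => MY.χ i w) w := by
    have := (hPsum ⟨w, hwmem⟩).mapL q₁.carrier.subtypeL
    simpa [q₁.χ_eq _ (hPm _ (Subtype.property _))] using this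
  -- a finite part of the partition carries most of the image
  obtain ⟨s, hs⟩ : ∃ s : Finset P, κ / 2 * ‖v‖ < ‖∑ i ∈ s, MY.χ i w‖ := by
    have h1 : κ / 2 * ‖v‖ < ‖w‖ := by nlinarith [mul_pos hκ hvpos]
    exact (hsum.norm.eventually (lt_mem_nhds h1)).exists
  have hs2 : (κ / 2 * ‖v‖) ^ 2 < ∑ i ∈ s, ‖MY.χ i w‖ ^ 2 := by
    rw [← norm_sum_chi_sq (B := fun i : P => (i : Set Y)) (fun i _ => hPY i)
      (fun i _ j _ hij => hdisj hij)]
    exact pow_lt_pow_left₀ hs (by positivity) two_ne_zero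
  -- one piece of the partition is mapped back to the expected place
  obtain ⟨i, hwi, hi⟩ : ∃ i : P, MY.χ i w ≠ 0 ∧
      ‖MX.χ A'ᶜ (adjoint T (MY.χ i w))‖ ≤ ε' * ‖MY.χ i w‖ := by
    by_contra! hcon
    have h1 := sum_norm_sq_le_of_norm_sum_le s
      (fun i : P => MX.χ A'ᶜ (adjoint T (MY.χ i w))) (c := ε' * κ / 4 * ‖v‖) fun J _ =>
        norm_sum_chi_adjoint_le hq (by positivity) hloc (B := fun i : P => (i : Set Y))
          (fun i _ => hPm i i.2) (fun i _ => hPG i i.2) (fun i _ j _ hij => hdisj hij) hAX hA'c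
          (Set.disjoint_iff_inter_eq_empty.1 (Set.disjoint_compl_left_iff_subset.2 hA'sub)) hAv
    have h2 : ∑ i ∈ s, (ε' * ‖MY.χ i w‖) ^ 2 ≤
        ∑ i ∈ s, ‖MX.χ A'ᶜ (adjoint T (MY.χ i w))‖ ^ 2 := by
      refine Finset.sum_le_sum fun i _ => ?_
      by_cases h0 : MY.χ i w = 0
      · simp [h0]
      · exact pow_le_pow_left₀ (by positivity) (hcon i h0).le 2
    simp_rw [mul_pow ε'] at h2
    rw [← Finset.mul_sum] at h2
    have h3 : ε' ^ 2 * (κ / 2 * ‖v‖) ^ 2 < ε' ^ 2 * ∑ i ∈ s, ‖MY.χ i w‖ ^ 2 := by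
      gcongr
    have h4 : (2 * (ε' * κ / 4 * ‖v‖)) ^ 2 = ε' ^ 2 * (κ / 2 * ‖v‖) ^ 2 := by ring
    linarith
  set wi := MY.χ i w with hwidef
  have hwipos : 0 < ‖wi‖ := norm_pos_iff.2 hwi
  have hwimem : wi ∈ q₁.carrier := Sub.chi_mem (hPm i i.2) hwmem
  set z := p₂.proj (adjoint T wi) with hz
  have hzmem : z ∈ p₂.carrier := Sub.proj_mem _
  set u := MX.χ A' z with hu
  have humem : u ∈ p₂.carrier := Sub.chi_mem hA'₂ hzmem
  have hTwi : ‖adjoint T wi‖ ≤ N * ‖wi‖ := by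
    refine (ContinuousLinearMap.le_opNorm _ _).trans ?_
    rw [LinearIsometryEquiv.norm_map]
    gcongr
  have hznorm : ‖z‖ ≤ N * ‖wi‖ := (Sub.norm_proj_apply_le _).trans hTwi
  have hunorm : ‖u‖ ≤ N * ‖wi‖ := (norm_chi_apply_le hA'X _).trans hznorm
  have hzlow : κ * ‖wi‖ ≤ ‖z‖ := by
    have := norm_sub_norm_le (adjoint T wi) z
    rw [norm_sub_rev] at this
    linarith [h₂ wi hwimem, hη' wi hwimem]
  -- the vector `u` is mapped to a vector that is visible on the chosen piece
  have hTu : κ ^ 2 / 2 * ‖wi‖ ≤ ‖MY.χ i (T u)‖ := by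
    have e1 : inner ℂ z (adjoint T wi) = (‖z‖ : ℂ) ^ 2 := by
      rw [← Sub.proj_eq hzmem, Sub.inner_proj, inner_self_eq_norm_sq_to_K, Sub.proj_eq hzmem]
      rfl
    -- Splitting along `A'`, the first term pairs `Tu` with `wi` and the second is the small error
    -- outside `A'`.
    have e2 : inner ℂ z (adjoint T wi) =
        inner ℂ u (adjoint T wi) + inner ℂ z (MX.χ A'ᶜ (adjoint T wi)) := by
      rw [← inner_chi hA'c, ← inner_add_left, chi_add_chi_compl hA'X]
    have e3 : inner ℂ u (adjoint T wi) = inner ℂ (MY.χ i (T u)) wi := by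
      rw [adjoint_inner_right, inner_chi (hPY i), hwidef,
        chi_chi_of_subset (hPY i) (hPY i) subset_rfl]
    have e4 : ‖z‖ ^ 2 ≤ ‖MY.χ i (T u)‖ * ‖wi‖ + ‖z‖ * ‖MX.χ A'ᶜ (adjoint T wi)‖ := by
      have : ‖z‖ ^ 2 = ‖(inner ℂ z (adjoint T wi) : ℂ)‖ := by rw [e1]; simp
      rw [this, e2, e3]
      exact (norm_add_le _ _).trans (add_le_add (norm_inner_le_norm _ _) (norm_inner_le_norm _ _))
    have e5 : ‖z‖ * ‖MX.χ A'ᶜ (adjoint T wi)‖ ≤ κ ^ 2 / 2 * ‖wi‖ * ‖wi‖ := by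
      calc _ ≤ (N * ‖wi‖) * (ε' * ‖wi‖) := by gcongr
        _ = _ := by rw [hε']; field_simp
    have e6 : (κ * ‖wi‖) ^ 2 ≤ ‖z‖ ^ 2 := by gcongr
    refine le_of_mul_le_mul_right ?_ hwipos
    nlinarith
  obtain ⟨B, hB, hBsub, hBhull⟩ := hullq (F'.preimage i)
  have hBY : B ∈ MY.meas := q₁.meas_subset hB
  refine ⟨B, hB, ?_, ?_⟩
  · have hBK : ∀ b ∈ B, ∀ y ∈ (i : Set Y), (b, y) ∈ K := by
      intro b hb y hy
      obtain ⟨c, ⟨d, hd, hcd⟩, hbc⟩ := hBhull hb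
      exact ⟨d, ⟨c, hbc, hcd⟩, hPG i i.2 ⟨hd, hy⟩⟩
    obtain ⟨y, hy⟩ := Setoid.nonempty_of_mem_partition hP i.2
    rintro ⟨b, b'⟩ ⟨hb, hb'⟩
    exact ⟨y, hBK b hb y hy, hBK b' hb' y hy⟩
  · have hvp₂ : v ∈ p₂.carrier := hp.1 (hp₀.1 hv)
    -- `Bᶜ` is `F'`-separated from piece `i`; since `Tu` is large on that piece, `Tv` must be small
    -- on `Bᶜ`.
    have h1 := norm_chi_mul_norm_chi_le (v := (⟨v, hvp₂⟩ : p₂.carrier))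
      (u := (⟨u, humem⟩ : p₂.carrier)) hloc' hA₂ hA'₂ (B := Bᶜ) (B' := i) ?_
      (MY.compl_mem _ hBY) (hPY i)
      (Set.disjoint_iff_inter_eq_empty.1 (Set.disjoint_compl_left_iff_subset.2 hBsub))
      (Subtype.ext ?_) (Subtype.ext ?_)
    · change ‖MY.χ Bᶜ (T v)‖ * ‖MY.χ i (T u)‖ ≤ ε * (κ ^ 2 / 2) / N * (‖v‖ * ‖u‖) at h1
      have h2 : ε * (κ ^ 2 / 2) / N * (‖v‖ * ‖u‖) ≤ ε * ‖v‖ * (κ ^ 2 / 2 * ‖wi‖) := by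
        calc _ ≤ ε * (κ ^ 2 / 2) / N * (‖v‖ * (N * ‖wi‖)) := by gcongr
          _ = _ := by field_simp
      have h3 : ‖MY.χ Bᶜ (T v)‖ * (κ ^ 2 / 2 * ‖wi‖) ≤ ‖MY.χ Bᶜ (T v)‖ * ‖MY.χ i (T u)‖ := by
        gcongr
      exact le_of_mul_le_mul_right (h3.trans (h1.trans h2)) (by positivity)
    · rintro ⟨a, a'⟩ ⟨ha, ha'⟩
      obtain ⟨b, ⟨c, hc, hbc⟩, hab⟩ := hA'hull ha'
      exact ⟨c, ⟨b, hab, hbc⟩, hAE ⟨hc, ha⟩⟩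
    · rw [p₂.χ_eq A hA₂]
      exact hAv
    · rw [p₂.χ_eq A' hA'₂]
      exact chi_chi_of_subset hA'X hA'X subset_rfl z

end Operators

/-! ### Approximating relations: adjoints, control and density. -/

section ApproxRel

variable {X Y : Type*} {𝓧 : CoarseStructure X} {𝓨 : CoarseStructure Y}
  {HX : Type*} [NormedAddCommGroup HX] [InnerProductSpace ℂ HX] [CompleteSpace HX]
  {HY : Type*} [NormedAddCommGroup HY] [InnerProductSpace ℂ HY] [CompleteSpace HY]
  {MX : CoarseModule 𝓧 HX} {MY : CoarseModule 𝓨 HY}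

theorem norm_chi_comp_adjoint (S : HX →L[ℂ] HY) {A : Set X} {B : Set Y} (hA : A ∈ MX.meas)
    (hB : B ∈ MY.meas) :
    ‖(MX.χ A).comp ((adjoint S).comp (MY.χ B))‖ = ‖(MY.χ B).comp (S.comp (MX.χ A))‖ := by
  rw [← LinearIsometryEquiv.norm_map adjoint ((MY.χ B).comp (S.comp (MX.χ A))),
    ContinuousLinearMap.adjoint_comp, ContinuousLinearMap.adjoint_comp, adjoint_chi hA,
    adjoint_chi hB]
  rfl

theorem approxRel_adjoint (S : HX →L[ℂ] HY) (δ : ℝ) (F : SetRel Y Y) (E : SetRel X X) :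
    approxRel MY MX (adjoint S) δ E F = (approxRel MX MY S δ F E).inv := by
  ext ⟨x, y⟩
  constructor
  · rintro ⟨A, hA, B, hB, hAE, hBF, h, hx, hy⟩
    exact ⟨B, hB, A, hA, hBF, hAE, norm_chi_comp_adjoint S hA hB ▸ h, hy, hx⟩
  · rintro ⟨B, hB, A, hA, hBF, hAE, h, hy, hx⟩
    exact ⟨A, hA, B, hB, hAE, hBF, (norm_chi_comp_adjoint S hA hB).symm ▸ h, hx, hy⟩

theorem adjoint_proj_comp (T : HX →L[ℂ] HY) (p : MX.Sub) (q : MY.Sub) :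
    adjoint (q.proj.comp (T.comp p.proj)) = p.proj.comp ((adjoint T).comp q.proj) := by
  rw [ContinuousLinearMap.adjoint_comp, ContinuousLinearMap.adjoint_comp, Sub.adjoint_proj,
    Sub.adjoint_proj]
  rfl

theorem adjoint_corestrict_comp (T : HX →L[ℂ] HY) (p : MX.Sub) (q : MY.Sub) :
    adjoint (q.corestrict.comp (T.comp p.incl)) =
      p.corestrict.comp ((adjoint T).comp q.incl) := by
  rw [ContinuousLinearMap.adjoint_comp, ContinuousLinearMap.adjoint_comp, Sub.adjoint_incl,
    Sub.adjoint_corestrict]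
  rfl

/-- The submodules have fewer measurable sets. Control is therefore proved for the larger relation
and density for the smaller one. -/
theorem approxRel_corestrict_subset (T : HX →L[ℂ] HY) (p : MX.Sub) (q : MY.Sub) (δ : ℝ)
    (F : SetRel Y Y) (E : SetRel X X) :
    approxRel p.toModule q.toModule (q.corestrict.comp (T.comp p.incl)) δ F E ⊆
      approxRel MX MY (q.proj.comp (T.comp p.proj)) δ F E := by
  rintro ⟨y, x⟩ ⟨B, hB, A, hA, hBF, hAE, h, hy, hx⟩
  refine ⟨B, q.meas_subset hB, A, p.meas_subset hA, hBF, hAE, h.trans_le ?_, hy, hx⟩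
  refine ContinuousLinearMap.opNorm_le_bound _ (norm_nonneg _) fun v => ?_
  have : ((q.toModule.χ B (q.corestrict (T (p.toModule.χ A v : p.carrier))) : q.carrier) : HY) =
      MY.χ B (q.proj (T (p.proj (MX.χ A v)))) := by
    rw [q.χ_eq B hB, p.χ_eq A hA, Sub.coe_corestrict, Sub.proj_eq (Sub.chi_mem hA v.2)]
  change ‖((q.toModule.χ B (q.corestrict (T (p.toModule.χ A v : p.carrier))) : q.carrier) : HY)‖ ≤ _
  rw [this]
  exact ContinuousLinearMap.le_opNorm
    ((MY.χ B).comp ((q.proj.comp (T.comp p.proj)).comp (MX.χ A))) (v : HX)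

/-- If a compression of `T` is bigger than `κ` between two sets, then this is witnessed by a vector
of the submodule, supported in any thickening that is measurable for the submodule. -/
theorem Sub.exists_norm_lt_of_lt_norm_comp {p : MX.Sub} {q : MY.Sub} {T : HX →L[ℂ] HY} {κ : ℝ}
    (hκ : 0 ≤ κ) {A A' : Set X} {B B' : Set Y} (hA : A ∈ MX.meas) (hA' : A' ∈ p.toModule.meas)
    (hAA' : A ⊆ A') (hB : B ∈ MY.meas) (hB' : B' ∈ q.toModule.meas) (hBB' : B ⊆ B')
    (h : κ < ‖(MY.χ B).comp ((q.proj.comp (T.comp p.proj)).comp (MX.χ A))‖) :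
    ∃ v ∈ p.carrier, MX.χ A' v = v ∧ κ * ‖v‖ < ‖MY.χ B' (T v)‖ := by
  obtain ⟨x, hx⟩ : ∃ x : HX, κ * ‖x‖ < ‖MY.χ B (q.proj (T (p.proj (MX.χ A x))))‖ := by
    by_contra! hcon
    exact h.not_ge (ContinuousLinearMap.opNorm_le_bound _ hκ hcon)
  refine ⟨p.proj (MX.χ A x), Sub.proj_mem _, ?_, ?_⟩
  · rw [← Sub.proj_chi hA', chi_chi_of_subset hA (p.meas_subset hA') hAA']
  · calc κ * ‖p.proj (MX.χ A x)‖ ≤ κ * ‖x‖ := by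
          gcongr
          exact (Sub.norm_proj_apply_le _).trans (norm_chi_apply_le hA _)
      _ < _ := hx
      _ = ‖MY.χ B (q.proj (MY.χ B' (T (p.proj (MX.χ A x)))))‖ := by
          rw [Sub.proj_chi hB', chi_chi_of_subset' hB (q.meas_subset hB') hBB']
      _ ≤ _ := (norm_chi_apply_le hB _).trans (Sub.norm_proj_apply_le _)

/-- The witnessing vectors satisfy `‖χ_{B₁}Tv‖ * ‖χ_{B₁'}Tu‖ > κ ^ 2 * ‖v‖ * ‖u‖`, so quasi-locality
with tolerance `κ ^ 2` prevents `B₁` and `B₁'` from being separated. The discrete modules supply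
hulls on which the compressing projections commute with `χ`. -/
theorem isControlled_approxRel {p₁ p₂ : MX.Sub} {q₁ q₂ : MY.Sub} (hp : p₁ ≤ p₂) (hq : q₁ ≤ q₂)
    (hpd : p₁.toModule.IsDiscrete) (hqd : q₁.toModule.IsDiscrete) {T : HX →L[ℂ] HY}
    (hw : IsWeaklyQuasiControlled p₂.toModule MY (T.comp p₂.incl)) {κ : ℝ} (hκ : 0 < κ)
    {E : SetRel X X} (hE : E ∈ 𝓧) {F : SetRel Y Y} (hF : F ∈ 𝓨) :
    IsControlled 𝓧 𝓨 (approxRel MX MY (q₂.proj.comp (T.comp p₂.proj)) κ F E) := by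
  intro D hD
  obtain ⟨Gp, hGp, hullp⟩ := hpd.exists_thickening
  obtain ⟨Gq, hGq, hullq⟩ := hqd.exists_thickening
  have hGpE := 𝓧.comp_mem _ hGp _ hE
  have hGqF := 𝓨.comp_mem _ hGq _ hF
  obtain ⟨F', hF', hloc⟩ := hw _ (𝓧.comp_mem _ hGpE _ (𝓧.comp_mem _ hD _ (𝓧.inv_mem _ hGpE)))
    (κ ^ 2) (by positivity)
  refine 𝓨.mem_of_subset _
    (𝓨.comp_mem _ (𝓨.inv_mem _ hGqF) _ (𝓨.comp_mem _ hF' _ hGqF)) _ ?_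
  rintro ⟨y, y'⟩ ⟨⟨x, x'⟩, hxx', ⟨B, hB, A, hA, hBF, hAE, h, hy, hx⟩,
    ⟨B', hB', A', hA', hBF', hAE', h', hy', hx'⟩⟩
  dsimp only at hy hx hy' hx'
  obtain ⟨A₁, hA₁, hAA₁, hA₁G⟩ := hullp A
  obtain ⟨A₁', hA₁', hAA₁', hA₁G'⟩ := hullp A'
  obtain ⟨B₁, hB₁, hBB₁, hB₁G⟩ := hullq B
  obtain ⟨B₁', hB₁', hBB₁', hB₁G'⟩ := hullq B'
  obtain ⟨v, hv, hAv, hTv⟩ :=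
    Sub.exists_norm_lt_of_lt_norm_comp hκ.le hA (hp.2 hA₁) hAA₁ hB (hq.2 hB₁) hBB₁ h
  obtain ⟨u, hu, hAu, hTu⟩ :=
    Sub.exists_norm_lt_of_lt_norm_comp hκ.le hA' (hp.2 hA₁') hAA₁' hB' (hq.2 hB₁') hBB₁' h'
  have hsep : ¬ B₁ ∩ F'.preimage B₁' = ∅ := by
    intro hsep
    have h1 := norm_chi_mul_norm_chi_le (v := (⟨v, hv⟩ : p₂.carrier))
      (u := (⟨u, hu⟩ : p₂.carrier)) hloc (hp.2 hA₁) (hp.2 hA₁') ?_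
      (q₁.meas_subset hB₁) (q₁.meas_subset hB₁') hsep
      (Subtype.ext ((p₂.χ_eq A₁ (hp.2 hA₁) _).trans hAv))
      (Subtype.ext ((p₂.χ_eq A₁' (hp.2 hA₁') _).trans hAu))
    · change ‖MY.χ B₁ (T v)‖ * ‖MY.χ B₁' (T u)‖ ≤ κ ^ 2 * (‖v‖ * ‖u‖) at h1
      have h2 := mul_lt_mul'' hTv hTu (by positivity) (by positivity)
      linarith
    · rintro ⟨a, a'⟩ ⟨ha, ha'⟩
      obtain ⟨b, hb, hab⟩ := hA₁G ha
      obtain ⟨b', hb', hab'⟩ := hA₁G' ha'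
      exact ⟨x, ⟨b, hab, hAE ⟨hb, hx⟩⟩, x', hxx', b', hab', hAE' ⟨hb', hx'⟩⟩
  obtain ⟨b, hb, b', hb', hbb'⟩ := Set.nonempty_iff_ne_empty.2 hsep
  obtain ⟨c, hc, hbc⟩ := hB₁G hb
  obtain ⟨c', hc', hbc'⟩ := hB₁G' hb'
  exact ⟨b, ⟨c, hbc, hBF ⟨hc, hy⟩⟩, b', hbb', c', hbc', hBF' ⟨hc', hy'⟩⟩

theorem coarselyDense_cod_approxRel {T : HX →L[ℂ] HY} {μ η δ : ℝ} (hμη : μ < η) (hμδ : μ < δ) (hδη : δ < η)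
    {p₀ p₁ p₂ : MX.Sub} {q₁ q₂ : MY.Sub} (hp₀ : p₀ ≤ p₁) (hp : p₁ ≤ p₂) (hq : q₁ ≤ q₂)
    (h₁ : ∀ v ∈ p₀.carrier, ‖q₁.proj (T v) - T v‖ ≤ μ * ‖v‖)
    (h₁' : ∀ v ∈ p₁.carrier, ‖q₂.proj (T v) - T v‖ ≤ μ * ‖v‖)
    (h₂ : ∀ w ∈ q₁.carrier, ‖p₂.proj (adjoint T w) - adjoint T w‖ ≤ μ * ‖w‖)
    (hpf : p₀.toModule.IsFaithful)
    (hpd : p₁.toModule.IsDiscrete) (hqd : q₁.toModule.IsDiscrete)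
    (hη : ∀ v ∈ p₁.carrier, η * ‖v‖ ≤ ‖T v‖)
    (hη' : ∀ w ∈ q₁.carrier, η * ‖w‖ ≤ ‖adjoint T w‖)
    (hw : IsWeaklyQuasiControlled p₂.toModule MY (T.comp p₂.incl))
    (hw' : IsWeaklyQuasiControlled q₂.toModule MX ((adjoint T).comp q₂.incl)) :
    ∃ E₀ ∈ 𝓧, ∃ F₀ ∈ 𝓨, ∀ (E : SetRel X X) (F : SetRel Y Y), E₀ ⊆ E → F₀ ⊆ F →
      𝓧.CoarselyDense (approxRel p₂.toModule q₂.toModule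
        (q₂.corestrict.comp (T.comp p₂.incl)) (δ - μ) F E).cod := by
  obtain ⟨G, hG, hdense⟩ := hpf
  -- Compression by `q₂` costs `μ` and cutting to `B` costs `(η - δ) / 2`, leaving a lower bound `η
  -- - μ - (η - δ) / 2 > δ - μ`.
  obtain ⟨F₀, hF₀, hconc⟩ := exists_concentration hμη hp₀ hp hq h₁ h₂ hpd hqd
    (fun v hv => hη v (hp₀.1 hv)) hη' hw hw' hG.1 (ε := (η - δ) / 2) (by linarith)
  refine ⟨G, hG.1, F₀, hF₀, fun E F hE hF => hdense.mono ?_⟩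
  rintro x ⟨A, ⟨hA, hAG, hA0⟩, hx⟩
  obtain ⟨v', hv'⟩ : ∃ v' : p₀.carrier, p₀.toModule.χ A v' ≠ 0 := by
    by_contra! hcon
    exact hA0 (ContinuousLinearMap.ext hcon)
  set v : HX := ((p₀.toModule.χ A v' : p₀.carrier) : HX) with hvdef
  have hvmem : v ∈ p₀.carrier := Subtype.property _
  have hv0 : v ≠ 0 := fun h => hv' (Subtype.ext h)
  have hvpos : 0 < ‖v‖ := norm_pos_iff.2 hv0
  have hAX := p₀.meas_subset hA
  have hAv : MX.χ A v = v := by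
    rw [hvdef, p₀.χ_eq A hA, chi_chi_of_subset hAX hAX subset_rfl]
  obtain ⟨B, hB, hBF, hBT⟩ := hconc A hA hAG v hvmem hAv hv0
  have hB₂ := hq.2 hB
  have hBY := q₂.meas_subset hB₂
  have hA₂ := hp.2 (hp₀.2 hA)
  have hv₂ : v ∈ p₂.carrier := hp.1 (hp₀.1 hvmem)
  have hlow : (δ - μ) * ‖v‖ < ‖MY.χ B (q₂.proj (T v))‖ := by
    have e1 : MY.χ B (q₂.proj (T v)) = T v - MY.χ Bᶜ (T v) + MY.χ B (q₂.proj (T v) - T v) := by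
      rw [map_sub, ← eq_sub_of_add_eq (chi_add_chi_compl hBY (T v))]
      abel
    have e2 : ‖MY.χ B (q₂.proj (T v) - T v)‖ ≤ μ * ‖v‖ :=
      (norm_chi_apply_le hBY _).trans (h₁' v (hp₀.1 hvmem))
    have e3 : ‖T v‖ - ‖MY.χ Bᶜ (T v)‖ - ‖MY.χ B (q₂.proj (T v) - T v)‖ ≤
        ‖MY.χ B (q₂.proj (T v))‖ := by
      have e4 : T v = MY.χ B (q₂.proj (T v)) + MY.χ Bᶜ (T v) -
          MY.χ B (q₂.proj (T v) - T v) := by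
        rw [e1]
        abel
      have e5 := norm_sub_le (MY.χ B (q₂.proj (T v)) + MY.χ Bᶜ (T v))
        (MY.χ B (q₂.proj (T v) - T v))
      rw [← e4] at e5
      linarith [norm_add_le (MY.χ B (q₂.proj (T v))) (MY.χ Bᶜ (T v))]
    nlinarith [hη v (hp₀.1 hvmem), mul_pos (sub_pos.2 hδη) hvpos]
  have hop : δ - μ < ‖(q₂.toModule.χ B).comp
      ((q₂.corestrict.comp (T.comp p₂.incl)).comp (p₂.toModule.χ A))‖ := by
    have h1 := ContinuousLinearMap.le_opNorm ((q₂.toModule.χ B).comp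
      ((q₂.corestrict.comp (T.comp p₂.incl)).comp (p₂.toModule.χ A))) ⟨v, hv₂⟩
    have h2 : ((q₂.toModule.χ B (q₂.corestrict (T (p₂.toModule.χ A ⟨v, hv₂⟩ : p₂.carrier))) :
        q₂.carrier) : HY) = MY.χ B (q₂.proj (T v)) := by
      rw [q₂.χ_eq B hB₂, p₂.χ_eq A hA₂, Sub.coe_corestrict, hAv]
    change ‖((q₂.toModule.χ B (q₂.corestrict (T (p₂.toModule.χ A ⟨v, hv₂⟩ : p₂.carrier))) :
        q₂.carrier) : HY)‖ ≤ _ * ‖v‖ at h1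
    rw [h2] at h1
    exact lt_of_mul_lt_mul_right (hlow.trans_le h1) hvpos.le
  -- A point of `B` is needed to place `x` in the codomain of the relation.
  have hB0 : B.Nonempty := by
    rw [Set.nonempty_iff_ne_empty]
    rintro rfl
    rw [MY.chi_empty, zero_apply, norm_zero] at hlow
    exact hlow.not_ge (mul_nonneg (sub_nonneg.2 hμδ.le) hvpos.le)
  obtain ⟨y, hy⟩ := hB0
  exact ⟨y, B, hB₂, A, hA₂, hBF.trans hF, hAG.trans hE, hop, hy, hx⟩

end ApproxRel

/-! ### A module as its own submodule, for the unitary case. -/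

section Top

variable {X : Type*} {𝓧 : CoarseStructure X} {H : Type*} [NormedAddCommGroup H]
  [InnerProductSpace ℂ H] [CompleteSpace H]

/-- A coarse geometric module as a submodule of itself. -/
noncomputable def Sub.top (M : CoarseModule 𝓧 H) : M.Sub where
  carrier := ⊤
  complete := completeSpace_coe_iff_isComplete.2 isComplete_univ
  toModule :=
    letI : CompleteSpace (⊤ : Submodule ℂ H) := completeSpace_coe_iff_isComplete.2 isComplete_univ
    { meas := M.meas
      univ_mem := M.univ_mem
      compl_mem := M.compl_mem
      inter_mem := M.inter_mem
      χ := fun A => ((M.χ A).comp (⊤ : Submodule ℂ H).subtypeL).codRestrict ⊤ fun _ => trivial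
      χ_proj := fun A hA => by
        refine ⟨?_, ?_⟩
        · ext v
          exact chi_chi_of_subset hA hA subset_rfl _
        · refine ((ContinuousLinearMap.eq_adjoint_iff _ _).2 fun v w => ?_).symm
          exact inner_chi hA _ _
      χ_inter := fun A hA A' hA' => by
        ext v
        exact (chi_inter_apply hA' hA _).symm
      χ_union := fun A hA A' hA' h => by
        ext v
        exact DFunLike.congr_fun (M.χ_union A hA A' hA' h) (v : H)
      χ_univ := by
        ext v
        exact DFunLike.congr_fun M.χ_univ (v : H)
      nondegenerate := by
        obtain ⟨E, hE, hd⟩ := M.nondegenerate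
        refine ⟨E, hE, Metric.dense_iff.2 fun x r hr => ?_⟩
        obtain ⟨y, hyx, hy⟩ := Metric.dense_iff.1 hd (x : H) r hr
        refine ⟨⟨y, trivial⟩, hyx, ?_⟩
        have hle : Submodule.span ℂ {v : H | ∃ A ∈ M.meas, IsBddBy E A ∧ v ∈ Set.range (M.χ A)} ≤
            Submodule.map (⊤ : Submodule ℂ H).subtype (Submodule.span ℂ {v | ∃ A ∈ M.meas,
              IsBddBy E A ∧ v ∈ Set.range (((M.χ A).comp
                (⊤ : Submodule ℂ H).subtypeL).codRestrict ⊤ fun _ => trivial)}) := by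
          refine Submodule.span_le.2 ?_
          rintro _ ⟨A, hA, hAE, w, rfl⟩
          exact ⟨⟨M.χ A w, trivial⟩, Submodule.subset_span ⟨A, hA, hAE, ⟨w, trivial⟩, rfl⟩, rfl⟩
        obtain ⟨z, hz, rfl⟩ := hle hy
        exact hz }
  meas_subset := subset_rfl
  χ_eq := fun _ _ _ => rfl

variable {M : CoarseModule 𝓧 H}

theorem IsFaithful.top (h : M.IsFaithful) : (Sub.top M).toModule.IsFaithful := by
  obtain ⟨G, hG, hd⟩ := h
  refine ⟨G, hG, hd.mono (Set.sUnion_subset_sUnion ?_)⟩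
  rintro A ⟨hA, hAG, hA0⟩
  refine ⟨hA, hAG, fun h => hA0 ?_⟩
  ext v
  exact congrArg Subtype.val (DFunLike.congr_fun h ⟨v, trivial⟩)

theorem IsDiscrete.top (h : M.IsDiscrete) : (Sub.top M).toModule.IsDiscrete := by
  obtain ⟨G, hG, P, hP, hPG, hPm, hsum, hC⟩ := h
  refine ⟨G, hG, P, hP, hPG, hPm, fun v => ?_, hC⟩
  exact (Topology.IsInducing.subtypeVal.hasSum_iff
    (g := (⊤ : Submodule ℂ H).subtype) _ _).1 (hsum v)

theorem IsWeaklyQuasiControlled.top {Y : Type*} {𝓨 : CoarseStructure Y} {H' : Type*}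
    [NormedAddCommGroup H'] [InnerProductSpace ℂ H'] [CompleteSpace H'] {M' : CoarseModule 𝓨 H'}
    {T : H →L[ℂ] H'} (h : IsWeaklyQuasiControlled M M' T) :
    IsWeaklyQuasiControlled (Sub.top M).toModule M' (T.comp (Sub.top M).incl) := by
  intro E hE ε hε
  obtain ⟨F, hF, hloc⟩ := h E hE ε hε
  refine ⟨F, hF, fun t ht => ?_⟩
  -- `s` is `t` transported along the identification of `⊤` with `H`; norm bound and propagation
  -- carry over.
  set s : H →L[ℂ] H := (Sub.top M).incl.comp (t.comp (Sub.top M).corestrict) with hs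
  have hst : Ad (T.comp (Sub.top M).incl) t = Ad T s := by
    rw [Ad, Ad, ContinuousLinearMap.adjoint_comp, Sub.adjoint_incl]
    rfl
  have hnorm : ‖s‖ ≤ ‖t‖ := by
    refine ContinuousLinearMap.opNorm_le_bound _ (norm_nonneg _) fun v => ?_
    refine (t.le_opNorm ((Sub.top M).corestrict v)).trans ?_
    gcongr
    exact Sub.norm_proj_apply_le v
  have hprop : M.HasPropagation E s := by
    intro A hA A' hA' hAA'
    ext v
    have h1 := congrArg Subtype.val (DFunLike.congr_fun (ht A hA A' hA' hAA') ⟨v, trivial⟩)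
    have h2 : (Sub.top M).corestrict (M.χ A v) = (Sub.top M).toModule.χ A ⟨v, trivial⟩ :=
      Subtype.ext (Sub.proj_eq (p := Sub.top M) trivial)
    change M.χ A' (t ((Sub.top M).corestrict (M.χ A v)) : (Sub.top M).carrier) = 0
    rw [h2]
    exact h1
  intro A hA A' hA' hAA'
  rw [hst]
  exact (hloc s hprop A hA A' hA' hAA').trans (by gcongr)

theorem Sub.proj_top : (Sub.top M).proj = ContinuousLinearMap.id ℂ H :=
  Submodule.starProjection_top

theorem Sub.le_refl (p : M.Sub) : p ≤ p := ⟨_root_.le_refl _, subset_rfl⟩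

end Top

/-! ### Rigidity along chains and for unitaries. -/

section Rigidity

variable {X Y : Type*} {𝓧 : CoarseStructure X} {𝓨 : CoarseStructure Y}
  {HX : Type*} [NormedAddCommGroup HX] [InnerProductSpace ℂ HX] [CompleteSpace HX]
  {HY : Type*} [NormedAddCommGroup HY] [InnerProductSpace ℂ HY] [CompleteSpace HY]
  {MX : CoarseModule 𝓧 HX} {MY : CoarseModule 𝓨 HY}

theorem Sub.norm_proj_sub_le {p : MX.Sub} {q : MY.Sub} {T : HX →L[ℂ] HY} {μ : ℝ}
    (h : ‖q.proj.comp (T.comp p.proj) - T.comp p.proj‖ ≤ μ) :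
    ∀ v ∈ p.carrier, ‖q.proj (T v) - T v‖ ≤ μ * ‖v‖ := by
  intro v hv
  have := ContinuousLinearMap.le_of_opNorm_le _ h v
  simpa [Sub.proj_eq hv] using this

/-- Rigidity for operators that are bounded below and weakly quasi-controlled along chains of
submodules. -/
theorem exists_isCoarseEquivWithInverse_approxRel {T : HX →L[ℂ] HY} {μ η : ℝ}
    {p₀ p₁ p₂ : MX.Sub} {q₀ q₁ q₂ : MY.Sub}
    (hp₀ : p₀ ≤ p₁) (hp : p₁ ≤ p₂) (hq₀ : q₀ ≤ q₁) (hq : q₁ ≤ q₂)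
    (h₁ : ‖q₁.proj.comp (T.comp p₀.proj) - T.comp p₀.proj‖ ≤ μ)
    (h₂ : ‖q₂.proj.comp (T.comp p₁.proj) - T.comp p₁.proj‖ ≤ μ)
    (h₁' : ‖p₁.proj.comp ((adjoint T).comp q₀.proj) - (adjoint T).comp q₀.proj‖ ≤ μ)
    (h₂' : ‖p₂.proj.comp ((adjoint T).comp q₁.proj) - (adjoint T).comp q₁.proj‖ ≤ μ)
    (hpf : p₀.toModule.IsFaithful) (hqf : q₀.toModule.IsFaithful)
    (hpd : p₁.toModule.IsDiscrete) (hqd : q₁.toModule.IsDiscrete)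
    (hη : ∀ v ∈ p₁.carrier, η * ‖v‖ ≤ ‖T v‖)
    (hη' : ∀ w ∈ q₁.carrier, η * ‖w‖ ≤ ‖adjoint T w‖)
    (hw : IsWeaklyQuasiControlled p₂.toModule MY (T.comp p₂.incl))
    (hw' : IsWeaklyQuasiControlled q₂.toModule MX ((adjoint T).comp q₂.incl))
    {δ : ℝ} (hμδ : μ < δ) (hδη : δ < η) :
    ∃ E₀ ∈ 𝓧, ∃ F₀ ∈ 𝓨, ∀ E ∈ 𝓧, ∀ F ∈ 𝓨, E₀ ⊆ E → F₀ ⊆ F →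
      IsCoarseEquivWithInverse 𝓧 𝓨
        (approxRel MX MY (q₂.proj.comp (T.comp p₂.proj)) (δ - μ) F E)
        (approxRel MY MX (p₂.proj.comp ((adjoint T).comp q₂.proj)) (δ - μ) E F) ∧
      IsCoarseEquivWithInverse 𝓧 𝓨
        (approxRel p₂.toModule q₂.toModule (q₂.corestrict.comp (T.comp p₂.incl)) (δ - μ) F E)
        (approxRel q₂.toModule p₂.toModule (p₂.corestrict.comp ((adjoint T).comp q₂.incl))
          (δ - μ) E F) := by
  have hμη := hμδ.trans hδη
  have hκ := sub_pos.2 hμδ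
  have k₁ := Sub.norm_proj_sub_le h₁
  have k₂ := Sub.norm_proj_sub_le h₂
  have k₁' := Sub.norm_proj_sub_le h₁'
  have k₂' := Sub.norm_proj_sub_le h₂'
  obtain ⟨E₁, hE₁, F₁, hF₁, hX⟩ := coarselyDense_cod_approxRel hμη hμδ hδη hp₀ hp hq k₁ k₂ k₂'
    hpf hpd hqd hη hη' hw hw'
  -- Density on the `Y` side is the same statement for `T*`, the two chains being exchanged.
  obtain ⟨F₂, hF₂, E₂, hE₂, hY⟩ := coarselyDense_cod_approxRel (T := adjoint T) hμη hμδ hδη hq₀ hq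
    hp k₁' k₂' (by rwa [adjoint_adjoint]) hqf hqd hpd hη' (by rwa [adjoint_adjoint]) hw'
    (by rwa [adjoint_adjoint])
  refine ⟨E₁ ∪ E₂, 𝓧.union_mem _ hE₁ _ hE₂, F₁ ∪ F₂, 𝓨.union_mem _ hF₁ _ hF₂,
    fun E hE F hF hE' hF' => ?_⟩
  obtain ⟨hE₁', hE₂'⟩ := Set.union_subset_iff.1 hE'
  obtain ⟨hF₁', hF₂'⟩ := Set.union_subset_iff.1 hF'
  have hXd := hX E F hE₁' hF₁'
  have hYd := hY F E hF₂' hE₂'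
  have hc := isControlled_approxRel hp hq hpd hqd hw hκ hE hF
  have hc' := isControlled_approxRel hq hp hqd hpd hw' hκ hF hE
  have hsub := approxRel_corestrict_subset T p₂ q₂ (δ - μ) F E
  rw [← adjoint_proj_comp, approxRel_adjoint] at hc' ⊢
  rw [← adjoint_corestrict_comp, approxRel_adjoint] at hYd ⊢
  -- Density passes up to the ambient relation and control passes down to the submodule relation.
  exact ⟨isCoarseEquivWithInverse_inv hc hc' (hXd.mono (SetRel.cod_mono hsub))
      (hYd.mono (SetRel.dom_mono hsub)),
    isCoarseEquivWithInverse_inv (hc.mono hsub) (hc'.mono (SetRel.inv_mono hsub)) hXd hYd⟩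

end Rigidity

end CoarseModule

theorem mainTheorem3
    {X Y : Type*} (𝓧 : CoarseStructure X) (𝓨 : CoarseStructure Y)
    {HX : Type*} [NormedAddCommGroup HX] [InnerProductSpace ℂ HX] [CompleteSpace HX]
    {HY : Type*} [NormedAddCommGroup HY] [InnerProductSpace ℂ HY] [CompleteSpace HY]
    (MX : CoarseModule 𝓧 HX) (MY : CoarseModule 𝓨 HY) :
    -- the general version, for operators restricted to chains of submodules
    (MX.IsLocallyAdmissible → MY.IsLocallyAdmissible →
      ∀ (T : HX →L[ℂ] HY) (μ η : ℝ), 0 ≤ μ → μ < η / 2 →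
      ∀ (p₀ p₁ p₂ : MX.Sub) (q₀ q₁ q₂ : MY.Sub),
        p₀ ≤ p₁ → p₁ ≤ p₂ → q₀ ≤ q₁ → q₁ ≤ q₂ →
        ‖q₁.proj.comp (T.comp p₀.proj) - T.comp p₀.proj‖ ≤ μ →
        ‖q₂.proj.comp (T.comp p₁.proj) - T.comp p₁.proj‖ ≤ μ →
        ‖p₁.proj.comp ((ContinuousLinearMap.adjoint T).comp q₀.proj)
            - (ContinuousLinearMap.adjoint T).comp q₀.proj‖ ≤ μ →
        ‖p₂.proj.comp ((ContinuousLinearMap.adjoint T).comp q₁.proj)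
            - (ContinuousLinearMap.adjoint T).comp q₁.proj‖ ≤ μ →
        p₀.toModule.IsFaithful → q₀.toModule.IsFaithful →
        p₁.toModule.IsDiscrete → q₁.toModule.IsDiscrete →
        (∀ v ∈ p₁.carrier, η * ‖v‖ ≤ ‖T v‖) →
        (∀ w ∈ q₁.carrier, η * ‖w‖ ≤ ‖ContinuousLinearMap.adjoint T w‖) →
        CoarseModule.IsWeaklyQuasiControlled p₂.toModule MY (T.comp p₂.incl) →
        CoarseModule.IsWeaklyQuasiControlled q₂.toModule MX
          ((ContinuousLinearMap.adjoint T).comp q₂.incl) →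
        ∀ δ : ℝ, μ < δ → δ < η →
          ∃ E₀ ∈ 𝓧, ∃ F₀ ∈ 𝓨, ∀ E ∈ 𝓧, ∀ F ∈ 𝓨, E₀ ⊆ E → F₀ ⊆ F →
            -- the compressed operators seen as operators between `HX` and `HY`
            IsCoarseEquivWithInverse 𝓧 𝓨
              (CoarseModule.approxRel MX MY (q₂.proj.comp (T.comp p₂.proj)) (δ - μ) F E)
              (CoarseModule.approxRel MY MX
                (p₂.proj.comp ((ContinuousLinearMap.adjoint T).comp q₂.proj)) (δ - μ) E F) ∧
            -- the compressed operators seen as operators between the submodules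
            IsCoarseEquivWithInverse 𝓧 𝓨
              (CoarseModule.approxRel p₂.toModule q₂.toModule
                (q₂.corestrict.comp (T.comp p₂.incl)) (δ - μ) F E)
              (CoarseModule.approxRel q₂.toModule p₂.toModule
                (p₂.corestrict.comp ((ContinuousLinearMap.adjoint T).comp q₂.incl))
                (δ - μ) E F)) ∧
    -- the version for unitaries
    (MX.IsFaithful → MX.IsDiscrete → MY.IsFaithful → MY.IsDiscrete →
      ∀ U : HX ≃ₗᵢ[ℂ] HY,
        CoarseModule.IsWeaklyQuasiControlled MX MY (U : HX →L[ℂ] HY) →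
        CoarseModule.IsWeaklyQuasiControlled MY MX
          (ContinuousLinearMap.adjoint (U : HX →L[ℂ] HY)) →
        ∀ δ : ℝ, 0 < δ → δ < 1 →
          ∃ E₀ ∈ 𝓧, ∃ F₀ ∈ 𝓨, ∀ E ∈ 𝓧, ∀ F ∈ 𝓨, E₀ ⊆ E → F₀ ⊆ F →
            IsCoarseEquivWithInverse 𝓧 𝓨
              (CoarseModule.approxRel MX MY (U : HX →L[ℂ] HY) δ F E)
              (CoarseModule.approxRel MY MX
                (ContinuousLinearMap.adjoint (U : HX →L[ℂ] HY)) δ E F)) := by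
  refine ⟨?_, ?_⟩
  · intro _ _ T μ η _ _ p₀ p₁ p₂ q₀ q₁ q₂ hp₀ hp hq₀ hq h₁ h₂ h₁' h₂' hpf hqf hpd hqd hη hη' hw hw'
      δ hμδ hδη
    exact CoarseModule.exists_isCoarseEquivWithInverse_approxRel hp₀ hp hq₀ hq h₁ h₂ h₁' h₂' hpf hqf
      hpd hqd hη hη' hw hw' hμδ hδη
  · intro hXf hXd hYf hYd U hU hU' δ hδ hδ1
    have hadj : ∀ w : HY, ‖ContinuousLinearMap.adjoint (U : HX →L[ℂ] HY) w‖ = ‖w‖ := by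
      intro w
      rw [LinearIsometryEquiv.adjoint_eq_symm]
      exact U.symm.norm_map w
    -- Constant chains at the whole module make every compression trivial, so `μ = 0`; a unitary is
    -- isometric, so `η = 1`.
    obtain ⟨E₀, hE₀, F₀, hF₀, h⟩ := CoarseModule.exists_isCoarseEquivWithInverse_approxRel
      (μ := 0) (η := 1) (T := (U : HX →L[ℂ] HY))
      (CoarseModule.Sub.le_refl (CoarseModule.Sub.top MX)) (CoarseModule.Sub.le_refl _)
      (CoarseModule.Sub.le_refl (CoarseModule.Sub.top MY)) (CoarseModule.Sub.le_refl _)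
      (by simp [CoarseModule.Sub.proj_top]) (by simp [CoarseModule.Sub.proj_top])
      (by simp [CoarseModule.Sub.proj_top]) (by simp [CoarseModule.Sub.proj_top])
      hXf.top hYf.top hXd.top hYd.top (fun v _ => by simp) (fun w _ => by rw [hadj, one_mul])
      hU.top hU'.top hδ hδ1
    refine ⟨E₀, hE₀, F₀, hF₀, fun E hE F hF hE' hF' => ?_⟩
    simpa only [CoarseModule.Sub.proj_top, ContinuousLinearMap.id_comp,
      ContinuousLinearMap.comp_id, sub_zero] using (h E hE F hF hE' hF').1
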